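/- Conventions. Fix an integer $\delta\ge 2$ and a real $\lambda>0$. For $a\ge 0$ let $\mathcal A_a$ be the set of entire functions $f:\mathbb C\to\mathbb C$ with $\sup_{k\ge 0} b^{-k}|f^{(k)}(0)|<\infty$ for every $b>a$. Let $\mathcal L$ be the set of Laguerre entire functions, i.e. functions of the form $$f(z)=Cz^m e^{\alpha z}\prod_{j=1}^\infty(1+\gamma_j z),\qquad C\in\mathbb C,\ m\in\mathbb N_0,\ \alpha\ge 0,\ \gamma_j\ge\gamma_{j+1}\ge 0,\ \sum_j\gamma_j<\infty,$$ let $\mathcal L^+=\{f\in\mathcal L: f(0)>0\}$ and $\mathcal L^+_a=\mathcal L^+\cap\mathcal A_a$. For $\theta\ge 0$ put $(\Delta_\theta f)(z)=\theta f'(z)+zf''(z)$. For $g\in\mathcal L^+$ with parameter $\alpha$ put $I(g)=[0,(\delta^\lambda-1)/\alpha]$ if $\alpha>0$ and $I(g)=[0,\infty)$ if $\alpha=0$. For $g\in\mathcal L^+$, $\tau\ge 0$ and $\theta\ge 0$ consider the renormalised Cauchy problem for functions $f_n(t,z)$: $f_0(1,z)=g(z)$ and, for $n\in\mathbb N=\{1,2,\dots\}$,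 $$\frac{\partial f_n(t,z)}{\partial t}=\tau(\Delta_\theta f_n)(t,z),\quad t\in[0,1],\ z\in\mathbb C,\qquad f_n(0,z)=\bigl[f_{n-1}(1,z\delta^{-1-\lambda})\bigr]^\delta .$$ A solution is understood in the spaces $\mathcal A_a$: for every $n\ge 1$ there is an $a\ge 0$ such that $f_n(t,\cdot)\in\mathcal A_a$ for all $t\in[0,1]$, and the equation holds at every point $(t,z)$ of $[0,1]\times\mathbb C$ (with one-sided derivatives in $t$ at $t=0,1$). Theorem. Let $g\in\mathcal L^+$, with parameter $\alpha$, and let $\tau\in I(g)$. Then for every $n\in\mathbb N$ and $\theta\ge 0$ the renormalised Cauchy problem has a unique solution $f_n$ (on $[0,1]\times\mathbb C$), and $f_n(t,\cdot)\in\mathcal L^+_\alpha$ for every $t\in[0,1]$. -/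

import Mathlib

open Set

noncomputable section

namespace LaguerreEvolution

/-- `𝓐_a`: the entire functions `f` with `sup_k b^{-k} |f^{(k)}(0)| < ∞` for every `b > a`. -/
def spaceA (a : ℝ) : Set (ℂ → ℂ) :=
  {f | Differentiable ℂ f ∧
    ∀ b : ℝ, a < b → BddAbove (range fun k : ℕ => (b ^ k)⁻¹ * ‖iteratedDeriv k f 0‖)}

/-- The representation `f(z) = C z^m exp(α z) ∏_j (1 + γ_j z)` of a Laguerre entire function.
The summability of `γ` makes the infinite product absolutely convergent for every `z`. -/
structure IsLaguerreRep (f : ℂ → ℂ) (C : ℂ) (m : ℕ) (α : ℝ) (γ : ℕ → ℝ) : Prop where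
  alpha_nonneg : 0 ≤ α
  gamma_nonneg : ∀ j, 0 ≤ γ j
  gamma_antitone : Antitone γ
  gamma_summable : Summable γ
  eq : ∀ z : ℂ, f z = C * z ^ m * Complex.exp ((α : ℂ) * z) * ∏' j : ℕ, (1 + (γ j : ℂ) * z)

/-- The class `𝓛` of Laguerre entire functions. -/
def laguerre : Set (ℂ → ℂ) :=
  {f | ∃ (C : ℂ) (m : ℕ) (α : ℝ) (γ : ℕ → ℝ), IsLaguerreRep f C m α γ}

/-- `𝓛⁺`: the Laguerre entire functions with `f(0)` real and positive. -/
def laguerrePos : Set (ℂ → ℂ) :=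
  {f | f ∈ laguerre ∧ ∃ r : ℝ, 0 < r ∧ f 0 = (r : ℂ)}

/-- `𝓛⁺_a = 𝓛⁺ ∩ 𝓐_a`. -/
def laguerrePosA (a : ℝ) : Set (ℂ → ℂ) := laguerrePos ∩ spaceA a

/-- `Δ_θ f = (θ + z D) D f`. -/
def deltaOp (θ : ℝ) (f : ℂ → ℂ) (z : ℂ) : ℂ :=
  (θ : ℂ) * deriv f z + z * deriv (deriv f) z

/-- The renormalisation `f ↦ [f(z δ^{-1-λ})]^δ`. -/
def renorm (δ : ℕ) (lam : ℝ) (f : ℂ → ℂ) (z : ℂ) : ℂ :=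
  (f (z * (((δ : ℝ) ^ (-1 - lam) : ℝ) : ℂ))) ^ δ

/-- `u` solves `∂u/∂t = τ Δ_θ u` on `[0,1] × ℂ` with `u(0,·) = h`, in one of the spaces `𝓐_a`:
all `u(t,·)` lie in a common `𝓐_a` (with any `a ≥ 0`, which may depend on `u`), and the equation
holds pointwise, with one-sided time derivatives at `t = 0` and `t = 1`. -/
structure IsCauchySolution (θ τ : ℝ) (h : ℂ → ℂ) (u : ℝ → ℂ → ℂ) : Prop where
  mem_spaceA : ∃ a : ℝ, 0 ≤ a ∧ ∀ t ∈ Icc (0 : ℝ) 1, u t ∈ spaceA a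
  init : u 0 = h
  equation : ∀ t ∈ Icc (0 : ℝ) 1, ∀ z : ℂ,
    HasDerivWithinAt (fun s : ℝ => u s z) ((τ : ℂ) * deltaOp θ (u t) z) (Icc 0 1) t

/-- `u` is a possible `n`-th member `f_n` of the renormalised Cauchy problem started from `g`:
`f_0(1,·) = g`, and `f_n` solves the Cauchy problem with initial value
`[f_{n-1}(1, z δ^{-1-λ})]^δ`, for a possible `(n-1)`-st member `f_{n-1}`. -/
def IsRenormSolution (δ : ℕ) (lam θ τ : ℝ) (g : ℂ → ℂ) : ℕ → (ℝ → ℂ → ℂ) → Prop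
  | 0, u => u 1 = g
  | n + 1, u => ∃ v : ℝ → ℂ → ℂ, IsRenormSolution δ lam θ τ g n v ∧
      IsCauchySolution θ τ (renorm δ lam (v 1)) u

/-- The set `I(g)`; it depends on `g` only through its parameter `α`. -/
def tauSet (δ : ℕ) (lam α : ℝ) : Set ℝ :=
  {τ | 0 ≤ τ ∧ (0 < α → τ ≤ ((δ : ℝ) ^ lam - 1) / α)}

end LaguerreEvolution

end

/-!
In terms of the derivatives `c_k = f^{(k)}(0)`, the operator `Δ_θ` is the weighted shift
`c_k ↦ (θ + k) c_{k+1}`, and `exp(s Δ_θ)` is an explicit series (`evolCoef`). The binomial series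
shows that it converts exponential type `b` into `b / (1 - b s)` as long as `b s < 1`
(`norm_evolCoef_le`). The renormalisation reduces the type from `α` to `α δ^{-λ}`, and the condition
`τ ∈ I(g)` says exactly that the evolution up to time `τ` brings it back to at most `α`
(`exists_step`). So each step is solved by the evolution operator (`hasDerivAt_egf_evolCoef`).

The Laguerre class enters through `LaguerreLimit`: the limits of polynomials with nonnegative
coefficients and real nonpositive zeros, with a uniform bound on the exponential type. Every `g` in
`𝓛⁺` is such a limit (`IsLaguerreRep.laguerreLimit`). The class is clearly preserved by the
renormalisation, and it is preserved by the evolution because `1 + (s/n) Δ_θ` preserves real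
nonpositive zeros (`ZeroFreeSlit.add_deltaOp`): off the cut `(-∞, 0]`, the quotient
`Δ_θ P / P = (P'/P) (θ + z P''/P')` is the product of an element of the cone spanned by `1, conj z`
and an element of the cone spanned by `1, z`, hence never a negative real number.
Conversely, each such limit is a Laguerre entire function (`LaguerreLimit.mem_laguerre`), by
compactness for the zeros and dominated convergence for the product of the factors
`(1 + γ_j z) e^{-γ_j z}`.

For uniqueness, a solution is only known to satisfy the equation pointwise and to lie in `𝓐_a` for
each `t`, without uniformity in `t`. If its growth is locally uniform in time, its Taylor
coefficients are differentiable and satisfy the coefficient system (`hasDerivWithinAt_coeff`), and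
Taylor's formula in `t` gives uniqueness (`coeff_eq_zero_of_short`). Local uniformity is a
consequence of Baire's theorem (`IsFlow.locallyUniformGrowth`): the times where it fails form a
closed set, on a portion of which the growth would be uniform, and the evolution operator carries
this bound over to the neighbouring intervals.
-/

open Set

noncomputable section

namespace LaguerreEvolution

open Filter Topology
open scoped Nat

/-! ### Exponential generating functions -/

/-- The exponential generating function `∑ c_k z^k / k!` of a sequence; its coefficients are the
derivatives at the origin, which makes it the natural coordinate on the spaces `𝓐_a`. -/
def egf (c : ℕ → ℂ) (z : ℂ) : ℂ := ∑' k : ℕ, c k * (z ^ k / (k ! : ℂ))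

lemma summable_pow_div_factorial_mul (K b x : ℝ) :
    Summable fun k : ℕ => K * b ^ k * (x ^ k / (k ! : ℝ)) := by
  have := (Real.summable_pow_div_factorial (b * x)).mul_left K
  refine this.congr fun k => ?_
  rw [mul_pow]; ring

lemma norm_egf_term_le {c : ℕ → ℂ} {K b : ℝ} (hc : ∀ k, ‖c k‖ ≤ K * b ^ k) (z : ℂ) (k : ℕ) :
    ‖c k * (z ^ k / (k ! : ℂ))‖ ≤ K * b ^ k * (‖z‖ ^ k / (k ! : ℝ)) := by
  rw [norm_mul, norm_div, norm_pow, Complex.norm_natCast]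
  exact mul_le_mul_of_nonneg_right (hc k) (by positivity)

lemma summable_egf {c : ℕ → ℂ} {K b : ℝ} (hc : ∀ k, ‖c k‖ ≤ K * b ^ k) (z : ℂ) :
    Summable fun k : ℕ => c k * (z ^ k / (k ! : ℂ)) :=
  Summable.of_norm_bounded (summable_pow_div_factorial_mul K b ‖z‖) (norm_egf_term_le hc z)

lemma norm_egf_le {c : ℕ → ℂ} {K b : ℝ} (hc : ∀ k, ‖c k‖ ≤ K * b ^ k) (z : ℂ) :
    ‖egf c z‖ ≤ K * Real.exp (b * ‖z‖) := by
  have h : HasSum (fun k : ℕ => K * b ^ k * (‖z‖ ^ k / (k ! : ℝ)))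
      (K * Real.exp (b * ‖z‖)) := by
    have := (NormedSpace.expSeries_div_hasSum_exp (b * ‖z‖)).mul_left K
    rw [← Real.exp_eq_exp_ℝ] at this
    refine this.congr_fun ?_
    intro k
    rw [mul_pow]; ring
  exact tsum_of_norm_bounded h (norm_egf_term_le hc z)

lemma hasDerivAt_egf {c : ℕ → ℂ} {K b : ℝ} (hc : ∀ k, ‖c k‖ ≤ K * b ^ k) (z : ℂ) :
    HasDerivAt (egf c) (egf (fun k => c (k + 1)) z) z := by
  have hK : 0 ≤ K := by simpa using (norm_nonneg _).trans (hc 0)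
  set R := ‖z‖ + 1
  have hR : 0 < R := by positivity
  have hz : z ∈ Metric.ball (0 : ℂ) R := by simp [R]
  let g' : ℕ → ℂ → ℂ := fun k y => c k * ((k : ℂ) * y ^ (k - 1) / (k ! : ℂ))
  have hsucc : ∀ k y, g' (k + 1) y = c (k + 1) * (y ^ k / (k ! : ℂ)) := by
    intro k y
    have h1 : (k ! : ℂ) ≠ 0 := by exact_mod_cast k.factorial_ne_zero
    have h2 : (k + 1 : ℂ) ≠ 0 := by exact_mod_cast k.succ_ne_zero
    simp only [g', Nat.factorial_succ]
    push_cast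
    field_simp
  let u : ℕ → ℝ := fun k => ‖c k‖ * (k * R ^ (k - 1) / (k ! : ℝ))
  have hu : Summable u := by
    rw [← summable_nat_add_iff 1]
    refine Summable.of_nonneg_of_le (fun k => by positivity) (fun k => ?_)
      (summable_pow_div_factorial_mul (K * b) b R)
    have h1 : (k ! : ℝ) ≠ 0 := by positivity
    have : ((k + 1 : ℕ) : ℝ) * R ^ (k + 1 - 1) / ((k + 1)! : ℝ) = R ^ k / (k ! : ℝ) := by
      simp only [Nat.factorial_succ]
      push_cast
      field_simp
    simp only [u]
    rw [this]
    refine mul_le_mul_of_nonneg_right ((hc _).trans_eq ?_) (by positivity)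
    ring
  have key := hasDerivAt_tsum_of_isPreconnected (u := u)
    (g := fun k (y : ℂ) => c k * (y ^ k / (k ! : ℂ))) (g' := g') hu Metric.isOpen_ball
    (convex_ball (0 : ℂ) R).isPreconnected (fun k y _ => by
      have := ((hasDerivAt_pow k y).div_const (k ! : ℂ)).const_mul (c k)
      simpa [g'] using this)
    (fun k y hy => by
      have hy' : ‖y‖ ≤ R := by simpa using (mem_ball_zero_iff.1 hy).le
      simp only [g', u, norm_mul, norm_div, norm_pow, Complex.norm_natCast]
      gcongr) hz (summable_egf hc z) hz
  have hsum : ∑' k, g' k z = egf (fun k => c (k + 1)) z := by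
    have hs : Summable fun k => g' k z := by
      rw [← summable_nat_add_iff 1]
      simp only [hsucc]
      refine summable_egf (K := K * b) (b := b) (fun k => (hc _).trans_eq ?_) z
      ring
    rw [hs.tsum_eq_zero_add]
    simp only [hsucc, egf]
    simp [g']
  rw [hsum] at key
  exact key

lemma shift_bound {c : ℕ → ℂ} {K b : ℝ} (hc : ∀ k, ‖c k‖ ≤ K * b ^ k) (n k : ℕ) :
    ‖c (k + n)‖ ≤ K * b ^ n * b ^ k := (hc _).trans_eq (by ring)

lemma iteratedDeriv_egf {K b : ℝ} (n : ℕ) {c : ℕ → ℂ}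
    (hc : ∀ k, ‖c k‖ ≤ K * b ^ k) :
    iteratedDeriv n (egf c) = egf (fun k => c (k + n)) := by
  induction n with
  | zero => simp
  | succ n ih =>
    rw [iteratedDeriv_succ, ih]
    funext z
    rw [(hasDerivAt_egf (shift_bound hc n) z).deriv]
    congr 1
    funext k
    congr 1
    ring

lemma egf_zero (c : ℕ → ℂ) : egf c 0 = c 0 := by
  unfold egf
  rw [tsum_eq_single 0]
  · simp
  · intro k hk
    simp [hk]

lemma iteratedDeriv_egf_zero {K b : ℝ} {c : ℕ → ℂ}
    (hc : ∀ k, ‖c k‖ ≤ K * b ^ k) (n : ℕ) : iteratedDeriv n (egf c) 0 = c n := by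
  rw [iteratedDeriv_egf n hc, egf_zero]; simp

/-- `Δ_θ` acts on Taylor coefficients by the weighted shift `c_k ↦ (θ + k) c_{k+1}`. -/
lemma deltaOp_egf (θ : ℝ) {c : ℕ → ℂ} {K b : ℝ} (hc : ∀ k, ‖c k‖ ≤ K * b ^ k)
    (z : ℂ) : deltaOp θ (egf c) z = egf (fun k => ((θ : ℂ) + k) * c (k + 1)) z := by
  have hd : deriv (egf c) = egf (fun k => c (k + 1)) := by
    funext y; exact (hasDerivAt_egf hc y).deriv
  have hdd : deriv (deriv (egf c)) z = egf (fun k => c (k + 2)) z := by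
    rw [hd, (hasDerivAt_egf (shift_bound hc 1) z).deriv]
  rw [deltaOp, hdd, hd]
  have s1 : Summable fun k : ℕ => c (k + 1) * (z ^ k / (k ! : ℂ)) :=
    summable_egf (shift_bound hc 1) z
  have s2 := summable_egf (shift_bound hc 2) z
  have hshift : ∀ k : ℕ, ((k + 1 : ℕ) : ℂ) * c (k + 1 + 1) * (z ^ (k + 1) / ((k + 1)! : ℂ))
      = z * (c (k + 2) * (z ^ k / (k ! : ℂ))) := by
    intro k
    have h1 : (k ! : ℂ) ≠ 0 := by exact_mod_cast k.factorial_ne_zero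
    have h2 : (k + 1 : ℂ) ≠ 0 := by exact_mod_cast k.succ_ne_zero
    simp only [Nat.factorial_succ]
    push_cast
    field_simp
    ring
  have s3 : Summable fun k : ℕ => (k : ℂ) * c (k + 1) * (z ^ k / (k ! : ℂ)) := by
    rw [← summable_nat_add_iff 1]
    simp only [hshift]
    exact s2.mul_left z
  have e3 : ∑' k : ℕ, (k : ℂ) * c (k + 1) * (z ^ k / (k ! : ℂ))
      = z * egf (fun k => c (k + 2)) z := by
    rw [s3.tsum_eq_zero_add]
    simp only [hshift]
    rw [tsum_mul_left]
    simp [egf]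
  rw [← e3]
  unfold egf
  rw [← tsum_mul_left, ← (s1.mul_left _).tsum_add s3]
  congr 1
  funext k
  ring

lemma geom_bound_of_mem_spaceA {f : ℂ → ℂ} {a b : ℝ} (hf : f ∈ spaceA a) (ha : 0 ≤ a)
    (hab : a < b) : ∃ K : ℝ, ∀ k, ‖iteratedDeriv k f 0‖ ≤ K * b ^ k := by
  obtain ⟨K, hK⟩ := hf.2 b hab
  refine ⟨K, fun k => ?_⟩
  have hb : 0 < b ^ k := pow_pos (ha.trans_lt hab) k
  have := hK ⟨k, rfl⟩
  simp only at this
  rwa [inv_mul_le_iff₀ hb, mul_comm] at this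

lemma eq_egf_of_differentiable {f : ℂ → ℂ} (hf : Differentiable ℂ f) :
    f = egf (fun k => iteratedDeriv k f 0) := by
  funext z
  rw [← Complex.taylorSeries_eq_of_entire' 0 z hf]
  unfold egf
  congr 1
  funext k
  simp
  ring

lemma egf_mem_spaceA {a : ℝ} (ha : 0 ≤ a) {c : ℕ → ℂ}
    (hc : ∀ b, a < b → ∃ K : ℝ, ∀ k, ‖c k‖ ≤ K * b ^ k) : egf c ∈ spaceA a := by
  refine ⟨fun z => ?_, fun b hb => ?_⟩
  · obtain ⟨K, hK⟩ := hc (a + 1) (by linarith)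
    exact (hasDerivAt_egf hK z).differentiableAt
  · obtain ⟨K, hK⟩ := hc b hb
    refine ⟨K, ?_⟩
    rintro _ ⟨k, rfl⟩
    have hb' : 0 < b ^ k := pow_pos (ha.trans_lt hb) k
    simp only
    rw [iteratedDeriv_egf_zero hK, inv_mul_le_iff₀ hb', mul_comm]
    exact hK k

lemma spaceA_mono {a a' : ℝ} (h : a ≤ a') : spaceA a ⊆ spaceA a' :=
  fun _ hf => ⟨hf.1, fun b hb => hf.2 b (h.trans_lt hb)⟩

/-- The passage from growth to coefficients: if nonnegative `a_k` satisfy `a_k x^k ≤ K e^{bx}` for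
all `x ≥ 0`, integration against `e^{-b'x}` bounds `k! a_k` by a multiple of `b'^k`, for every
`b' > b`. In contrast to an optimal choice of `x`, no power of `k` is lost. -/
lemma factorial_mul_le_of_growth {b b' : ℝ} (hb : 0 ≤ b) (hbb : b < b') (K : ℝ) :
    ∃ K' : ℝ, ∀ (k : ℕ) (A : ℝ), (∀ x : ℝ, 0 ≤ x → A * x ^ k ≤ K * Real.exp (b * x)) →
      (k ! : ℝ) * A ≤ K' * b' ^ k := by
  have hb' : 0 < b' := hb.trans_lt hbb
  refine ⟨K / (b' - b) * b', fun k A h => ?_⟩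
  have hint := Real.integral_rpow_mul_exp_neg_mul_Ioi (a := (k : ℝ) + 1) (r := b')
    (by positivity) hb'
  have hint0 := Real.integral_rpow_mul_exp_neg_mul_Ioi (a := 1) (r := b' - b) one_pos (by linarith)
  have hI1 : MeasureTheory.IntegrableOn
      (fun t : ℝ => t ^ ((k : ℝ) + 1 - 1) * Real.exp (-(b' * t))) (Ioi 0) := by
    by_contra hcon
    rw [MeasureTheory.integral_undef hcon] at hint
    have : 0 < (1 / b') ^ ((k : ℝ) + 1) * Real.Gamma ((k : ℝ) + 1) :=
      mul_pos (by positivity) (Real.Gamma_pos_of_pos (by positivity))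
    linarith
  have hI0 : MeasureTheory.IntegrableOn
      (fun t : ℝ => t ^ ((1 : ℝ) - 1) * Real.exp (-((b' - b) * t))) (Ioi 0) := by
    by_contra hcon
    rw [MeasureTheory.integral_undef hcon] at hint0
    have : 0 < (1 / (b' - b)) ^ (1 : ℝ) * Real.Gamma 1 := by
      have : 0 < b' - b := by linarith
      exact mul_pos (by positivity) (Real.Gamma_pos_of_pos one_pos)
    linarith
  have hmono := MeasureTheory.setIntegral_mono_on (hI1.const_mul A) (hI0.const_mul K)
    measurableSet_Ioi (fun x hx => by
      have hx' : 0 ≤ x := le_of_lt hx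
      have := mul_le_mul_of_nonneg_right (h x hx') (Real.exp_pos (-(b' * x))).le
      rw [mul_assoc K, ← Real.exp_add] at this
      have e1 : b * x + -(b' * x) = -((b' - b) * x) := by ring
      rw [e1] at this
      simpa [mul_assoc] using this)
  rw [MeasureTheory.integral_const_mul, MeasureTheory.integral_const_mul, hint, hint0,
    Real.Gamma_nat_eq_factorial] at hmono
  simp only [Real.rpow_one, Real.Gamma_one, mul_one] at hmono
  have e2 : (1 / b') ^ ((k : ℝ) + 1) = 1 / b' ^ (k + 1) := by
    rw [show ((k : ℝ) + 1) = ((k + 1 : ℕ) : ℝ) by push_cast; ring, Real.rpow_natCast]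
    simp
  rw [e2] at hmono
  have hpos : 0 < b' ^ (k + 1) := by positivity
  have := mul_le_mul_of_nonneg_right hmono hpos.le
  calc (k ! : ℝ) * A = A * (1 / b' ^ (k + 1) * (k ! : ℝ)) * b' ^ (k + 1) := by
        field_simp
    _ ≤ _ := this
    _ = _ := by ring

/-! ### Polynomials without zeros off the nonpositive half-line -/

/-- The complex polynomial has no zeros in the complex plane slit along `(-∞, 0]`; for a nonzero
polynomial this says that all its zeros are real and nonpositive. -/
def ZeroFreeSlit (P : Polynomial ℂ) : Prop := ∀ z ∈ Complex.slitPlane, P.eval z ≠ 0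

lemma not_mem_slitPlane_iff {z : ℂ} : z ∉ Complex.slitPlane ↔ z.re ≤ 0 ∧ z.im = 0 := by
  simp [Complex.mem_slitPlane_iff]

lemma ZeroFreeSlit.derivative {P : Polynomial ℂ} (hP : ZeroFreeSlit P)
    (hd : P.derivative ≠ 0) : ZeroFreeSlit P.derivative := by
  intro z hz h0
  have hdeg : 0 < P.degree := by
    by_contra hcon
    exact hd (by rw [Polynomial.eq_C_of_degree_le_zero (not_lt.1 hcon)]; simp)
  have hmem : z ∈ P.derivative.rootSet ℂ := by
    rw [Polynomial.mem_rootSet]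
    exact ⟨hd, by simpa using h0⟩
  have hconv : Convex ℝ {w : ℂ | w.re ≤ 0 ∧ w.im = 0} := by
    have h1 : Convex ℝ {w : ℂ | w.re ≤ 0} := convex_halfSpace_re_le 0
    have h2 : Convex ℝ {w : ℂ | w.im = 0} :=
      convex_hyperplane ⟨Complex.add_im, fun c x => by simp⟩ 0
    exact h1.inter h2
  have hsub : P.rootSet ℂ ⊆ {w : ℂ | w.re ≤ 0 ∧ w.im = 0} := by
    intro w hw
    rw [Polynomial.mem_rootSet] at hw
    by_contra hcon
    refine hP w ?_ (by simpa using hw.2)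
    by_contra h
    exact hcon (not_mem_slitPlane_iff.1 h)
  have := convexHull_min hsub hconv
    (Polynomial.rootSet_derivative_subset_convexHull_rootSet hdeg hmem)
  exact not_mem_slitPlane_iff.2 this hz

lemma multiset_sum_mem_cone (w : ℂ) (s : Multiset ℂ)
    (hs : ∀ x ∈ s, ∃ p q : ℝ, 0 ≤ p ∧ 0 ≤ q ∧ x = p + q * w) :
    ∃ p q : ℝ, 0 ≤ p ∧ 0 ≤ q ∧ s.sum = p + q * w := by
  induction s using Multiset.induction with
  | empty => exact ⟨0, 0, le_rfl, le_rfl, by simp⟩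
  | cons a s ih =>
    obtain ⟨p, q, hp, hq, h⟩ := ih fun x hx => hs x (Multiset.mem_cons_of_mem hx)
    obtain ⟨p', q', hp', hq', h'⟩ := hs a (Multiset.mem_cons_self a s)
    refine ⟨p' + p, q' + q, by positivity, by positivity, ?_⟩
    rw [Multiset.sum_cons, h, h']
    push_cast
    ring

/-- With all zeros in `(-∞, 0]`, the logarithmic derivative lies in the cone spanned by `1` and
`conj z`. -/
lemma ZeroFreeSlit.logDeriv_mem_cone {P : Polynomial ℂ} (hP : ZeroFreeSlit P) {z : ℂ}
    (hz : z ∈ Complex.slitPlane) : ∃ p q : ℝ, 0 ≤ p ∧ 0 ≤ q ∧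
      P.derivative.eval z / P.eval z = p + q * (starRingEnd ℂ) z := by
  rw [(IsAlgClosed.splits P).eval_derivative_div_eval_of_ne_zero (hP z hz)]
  refine multiset_sum_mem_cone _ _ ?_
  intro x hx
  obtain ⟨r, hr, rfl⟩ := Multiset.mem_map.1 hx
  have hr0 : P.eval r = 0 := (Polynomial.mem_roots'.1 hr).2
  have hrs : r.re ≤ 0 ∧ r.im = 0 := not_mem_slitPlane_iff.1 fun h => hP r h hr0
  obtain ⟨ρ, rfl⟩ : ∃ ρ : ℝ, r = ρ := ⟨r.re, Complex.ext (by simp) (by simp [hrs.2])⟩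
  rw [Complex.ofReal_re] at hrs
  refine ⟨-ρ / Complex.normSq (z - ρ), 1 / Complex.normSq (z - ρ),
    div_nonneg (by linarith [hrs.1]) (Complex.normSq_nonneg _),
    div_nonneg one_pos.le (Complex.normSq_nonneg _), ?_⟩
  rw [one_div, Complex.inv_def, map_sub, Complex.conj_ofReal]
  push_cast
  ring

/-- The product of an element of the cone spanned by `1, conj z` with an element of the cone
spanned by `1, z` has its argument in `[-arg z, arg z]`, so that it is never real and negative. -/
lemma cone_mul_cone_ne_neg {z : ℂ} (hz : z ∈ Complex.slitPlane) {p q r t : ℝ} (hp : 0 ≤ p)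
    (hq : 0 ≤ q) (hr : 0 ≤ r) (ht : 0 ≤ t) {s : ℝ} (hs : 0 ≤ s) :
    1 + (s : ℂ) * ((p + q * (starRingEnd ℂ) z) * (r + t * z)) ≠ 0 := by
  intro h
  have hre := congrArg Complex.re h
  have him := congrArg Complex.im h
  obtain ⟨x, y⟩ := z
  simp [Complex.mem_slitPlane_iff] at hz
  simp at hre him
  set X := (p + q * x) * (r + t * x) + q * y * (t * y) with hX
  have hre' : 1 + s * X = 0 := by rw [hX]; linarith
  have hXneg : X < 0 := by
    by_contra hcon
    have := mul_nonneg hs (not_lt.1 hcon)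
    linarith
  have him' : s * ((p * t - q * r) * y) = 0 := by
    rcases him with h | h
    · rw [h, zero_mul]
    · linear_combination s * h
  have hs0 : s ≠ 0 := by rintro rfl; simp at hre'
  have h2 := (mul_eq_zero.1 him').resolve_left hs0
  rcases mul_eq_zero.1 h2 with h3 | h3
  · have hpt : p * t = q * r := by linarith
    -- `(pr)(qt) = (pt)²`, so `pr + qt |z|² + 2 pt x` is at least a square
    have h4 : (p * r) * (q * t) = (p * t) ^ 2 := by
      calc (p * r) * (q * t) = (p * t) * (q * r) := by ring
        _ = _ := by rw [← hpt]; ring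
    have h5 : X = p * r + 2 * (p * t) * x + q * t * (x ^ 2 + y ^ 2) := by
      rw [hX]; linear_combination (-x) * hpt
    rcases eq_or_lt_of_le (mul_nonneg hq ht) with h6 | h6
    · have h7 : p * t = 0 := by
        have : (p * t) ^ 2 = 0 := by rw [← h4, ← h6]; ring
        exact pow_eq_zero_iff (two_ne_zero) |>.1 this
      rw [h5, h7, ← h6] at hXneg
      nlinarith [mul_nonneg hp hr]
    · have : q * t * X = (p * t + q * t * x) ^ 2 + (q * t) ^ 2 * y ^ 2 := by
        rw [h5]; linear_combination h4
      have h8 : 0 ≤ q * t * X := by rw [this]; positivity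
      nlinarith
  · rcases hz with hz | hz
    · rw [h3] at hX
      have : 0 ≤ X := by rw [hX]; positivity
      linarith
    · exact hz h3

/-- `1 + sΔ_θ`, with `s, θ ≥ 0`, preserves the polynomials whose zeros are real and nonpositive:
off the cut, `Δ_θ P / P = (P'/P) (θ + z P''/P')` is a product of elements of opposite cones. -/
lemma ZeroFreeSlit.add_deltaOp {P : Polynomial ℂ} (hP : ZeroFreeSlit P) {s θ : ℝ} (hs : 0 ≤ s)
    (hθ : 0 ≤ θ) :
    ZeroFreeSlit (P + Polynomial.C (s : ℂ) * (Polynomial.C (θ : ℂ) * P.derivative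
      + Polynomial.X * P.derivative.derivative)) := by
  intro z hz
  by_cases hd : P.derivative = 0
  · simpa [hd] using hP z hz
  have hP' := hP.derivative hd
  obtain ⟨p, q, hp, hq, h1⟩ := hP.logDeriv_mem_cone hz
  obtain ⟨r, t, hr, ht, h2⟩ := hP'.logDeriv_mem_cone hz
  have h0 := hP z hz
  have h0' := hP' z hz
  have key := cone_mul_cone_ne_neg hz hp hq (r := θ + t * Complex.normSq z) (t := r)
    (by have := Complex.normSq_nonneg z; positivity) hr hs
  have e : ((θ + t * Complex.normSq z : ℝ) : ℂ) + r * z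
      = θ + z * (P.derivative.derivative.eval z / P.derivative.eval z) := by
    rw [h2]; push_cast; rw [Complex.normSq_eq_conj_mul_self]; ring
  rw [e, ← h1] at key
  intro hcon
  apply key
  have : (P.eval z) * (1 + (s : ℂ) * (P.derivative.eval z / P.eval z *
      (θ + z * (P.derivative.derivative.eval z / P.derivative.eval z)))) = 0 := by
    rw [← hcon]
    simp only [Polynomial.eval_add, Polynomial.eval_mul, Polynomial.eval_C, Polynomial.eval_X]
    field_simp
  exact (mul_eq_zero.1 this).resolve_left h0

/-! ### The evolution operator on Taylor coefficients -/

/-- The rising factorial `x (x + 1) ⋯ (x + n - 1)`. -/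
def rising (x : ℝ) (n : ℕ) : ℝ := ∏ i ∈ Finset.range n, (x + i)

lemma rising_zero (x : ℝ) : rising x 0 = 1 := by simp [rising]

lemma rising_succ (x : ℝ) (n : ℕ) : rising x (n + 1) = x * rising (x + 1) n := by
  unfold rising
  rw [Finset.prod_range_succ', mul_comm]
  congr 1
  · simp
  · refine Finset.prod_congr rfl fun i _ => ?_
    push_cast; ring

lemma rising_nonneg {x : ℝ} (hx : 0 ≤ x) (n : ℕ) : 0 ≤ rising x n :=
  Finset.prod_nonneg fun i _ => by positivity

/-- The bound by a binomial coefficient makes the series in `n` summable in closed form, and its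
index is linear in `k`, so that no more than a geometric factor in `k` arises. -/
lemma rising_div_factorial_le {θ : ℝ} (hθ : 0 ≤ θ) (k n : ℕ) :
    rising (θ + k) n / (n ! : ℝ) ≤ ((n + (⌈θ⌉₊ + k)).choose (⌈θ⌉₊ + k) : ℝ) := by
  have h1 : rising (θ + k) n ≤ (((⌈θ⌉₊ + k + 1).ascFactorial n : ℕ) : ℝ) := by
    rw [Nat.ascFactorial_eq_prod_range]
    push_cast
    refine Finset.prod_le_prod (fun i _ => by positivity) fun i _ => ?_
    have := Nat.le_ceil θ
    linarith
  rw [div_le_iff₀ (by positivity)]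
  refine h1.trans (le_of_eq ?_)
  rw [Nat.ascFactorial_eq_factorial_mul_choose]
  push_cast
  rw [mul_comm, add_comm n, Nat.choose_symm_add]

/-- The Taylor coefficients of `exp(s Δ_θ) f`, in terms of those of `f`. -/
def evolCoef (θ s : ℝ) (c : ℕ → ℂ) (k : ℕ) : ℂ :=
  ∑' n : ℕ, ((s ^ n * (rising (θ + k) n / (n ! : ℝ)) : ℝ) : ℂ) * c (k + n)

lemma norm_evolCoef_term_le {θ S K b : ℝ} (hθ : 0 ≤ θ) {c : ℕ → ℂ}
    (hc : ∀ k, ‖c k‖ ≤ K * b ^ k) {s : ℝ} (hs : |s| ≤ S) (k n : ℕ) :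
    ‖((s ^ n * (rising (θ + k) n / (n ! : ℝ)) : ℝ) : ℂ) * c (k + n)‖ ≤
      K * b ^ k * (((n + (⌈θ⌉₊ + k)).choose (⌈θ⌉₊ + k) : ℝ) * (b * S) ^ n) := by
  have hK : 0 ≤ K := by simpa using (norm_nonneg _).trans (hc 0)
  have hr : 0 ≤ rising (θ + k) n / (n ! : ℝ) :=
    div_nonneg (rising_nonneg (by positivity) n) (by positivity)
  rw [norm_mul, Complex.norm_real, norm_mul, norm_pow, Real.norm_eq_abs,
    Real.norm_of_nonneg hr]
  calc |s| ^ n * (rising (θ + k) n / (n ! : ℝ)) * ‖c (k + n)‖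
      ≤ S ^ n * ((n + (⌈θ⌉₊ + k)).choose (⌈θ⌉₊ + k) : ℝ) * (K * b ^ (k + n)) := by
        have hS : 0 ≤ S := (abs_nonneg s).trans hs
        have := hc (k + n)
        gcongr
        exact rising_div_factorial_le hθ k n
    _ = _ := by rw [mul_pow, pow_add]; ring

lemma hasSum_evolBound {x : ℝ} (hx0 : 0 ≤ x) (hx : x < 1) (A : ℝ) (m : ℕ) :
    HasSum (fun n : ℕ => A * (((n + m).choose m : ℝ) * x ^ n)) (A * (1 / (1 - x) ^ (m + 1))) := by
  have hx' : ‖x‖ < 1 := by rwa [Real.norm_of_nonneg hx0]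
  have h := (summable_choose_mul_geometric_of_norm_lt_one m hx').hasSum
  rw [tsum_choose_mul_geometric_of_norm_lt_one m hx'] at h
  exact h.mul_left A

lemma summable_evolCoef {θ K b s : ℝ} (hθ : 0 ≤ θ) (hb : 0 < b) {c : ℕ → ℂ}
    (hc : ∀ k, ‖c k‖ ≤ K * b ^ k) (hs : b * |s| < 1) (k : ℕ) :
    Summable fun n : ℕ => ((s ^ n * (rising (θ + k) n / (n ! : ℝ)) : ℝ) : ℂ) * c (k + n) :=
  Summable.of_norm_bounded
    (hasSum_evolBound (by positivity) hs (K * b ^ k) (⌈θ⌉₊ + k)).summable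
    (norm_evolCoef_term_le hθ hc le_rfl k)

/-- The evolution for time `s` maps coefficients of type `b` to coefficients of type
`b / (1 - b s)`. -/
lemma norm_evolCoef_le {θ S K b s : ℝ} (hθ : 0 ≤ θ) (hb : 0 < b) {c : ℕ → ℂ}
    (hc : ∀ k, ‖c k‖ ≤ K * b ^ k) (hs : |s| ≤ S) (hS : b * S < 1) (k : ℕ) :
    ‖evolCoef θ s c k‖ ≤ K / (1 - b * S) ^ (⌈θ⌉₊ + 1) * (b / (1 - b * S)) ^ k := by
  have hS0 : 0 ≤ S := (abs_nonneg s).trans hs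
  refine (tsum_of_norm_bounded
    (hasSum_evolBound (by positivity) hS (K * b ^ k) (⌈θ⌉₊ + k))
    (norm_evolCoef_term_le hθ hc hs k)).trans_eq ?_
  rw [div_pow, show ⌈θ⌉₊ + k + 1 = ⌈θ⌉₊ + 1 + k by ring, pow_add (1 - b * S)]
  have : 0 < 1 - b * S := by linarith
  field_simp

lemma evolCoef_zero (θ : ℝ) (c : ℕ → ℂ) : evolCoef θ 0 c = c := by
  funext k
  unfold evolCoef
  rw [tsum_eq_single 0]
  · simp [rising_zero]
  · intro n hn
    simp [hn]

lemma hasDerivAt_evolCoef {θ K b s : ℝ} (hθ : 0 ≤ θ) (hb : 0 < b) {c : ℕ → ℂ}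
    (hc : ∀ k, ‖c k‖ ≤ K * b ^ k) (hs : b * |s| < 1) (k : ℕ) :
    HasDerivAt (fun r : ℝ => evolCoef θ r c k)
      (((θ : ℂ) + k) * evolCoef θ s c (k + 1)) s := by
  have hK : 0 ≤ K := by simpa using (norm_nonneg _).trans (hc 0)
  obtain ⟨S, hsS, hS1⟩ : ∃ S, |s| < S ∧ S < 1 / b :=
    exists_between ((lt_div_iff₀ hb).2 (by linarith))
  have hbS : b * S < 1 := by rw [lt_div_iff₀ hb] at hS1; linarith
  have hS0 : 0 ≤ S := (abs_nonneg s).trans hsS.le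
  have hmem : s ∈ Metric.ball (0 : ℝ) S := by simpa using hsS
  let g' : ℕ → ℝ → ℂ := fun n r =>
    ((((n : ℝ) * r ^ (n - 1)) * (rising (θ + k) n / (n ! : ℝ)) : ℝ) : ℂ) * c (k + n)
  have hsucc : ∀ n r, g' (n + 1) r = ((θ : ℂ) + k) *
      (((r ^ n * (rising (θ + (k + 1 : ℕ)) n / (n ! : ℝ)) : ℝ) : ℂ) * c (k + 1 + n)) := by
    intro n r
    have h1 : (n ! : ℂ) ≠ 0 := by exact_mod_cast n.factorial_ne_zero
    have h2 : (n + 1 : ℂ) ≠ 0 := by exact_mod_cast n.succ_ne_zero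
    simp only [g', Nat.factorial_succ, rising_succ]
    rw [show k + 1 + n = k + (n + 1) by ring, show θ + (k : ℝ) + 1 = θ + ((k + 1 : ℕ) : ℝ) by
      push_cast; ring]
    push_cast
    field_simp
  let u : ℕ → ℝ := fun n => ‖g' n S‖
  have hu : Summable u := by
    rw [← summable_nat_add_iff 1]
    simp only [u, hsucc]
    exact (Summable.of_norm_bounded
      (hasSum_evolBound (by positivity) hbS (K * b ^ (k + 1)) (⌈θ⌉₊ + (k + 1))).summable
      (fun n => by
        rw [norm_norm]
        exact norm_evolCoef_term_le hθ hc (abs_of_nonneg hS0).le (k + 1) n)).mul_left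
          ‖(θ : ℂ) + k‖ |>.congr fun n => (norm_mul _ _).symm
  have key := hasDerivAt_tsum_of_isPreconnected (u := u)
    (g := fun n (r : ℝ) => ((r ^ n * (rising (θ + k) n / (n ! : ℝ)) : ℝ) : ℂ) * c (k + n))
    (g' := g') hu Metric.isOpen_ball (convex_ball (0 : ℝ) S).isPreconnected (fun n r _ => by
      exact (((hasDerivAt_pow n r).mul_const _).ofReal_comp).mul_const _)
    (fun n r hr => by
      have hr' : |r| ≤ S := by simpa using (mem_ball_zero_iff.1 hr).le
      simp only [g', u, norm_mul, Complex.norm_real, norm_pow, Real.norm_eq_abs,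
        abs_of_nonneg hS0]
      gcongr) hmem (summable_evolCoef hθ hb hc hs k) hmem
  have hsum : ∑' n, g' n s = ((θ : ℂ) + k) * evolCoef θ s c (k + 1) := by
    have hsm : Summable fun n => g' n s := by
      rw [← summable_nat_add_iff 1]
      simp only [hsucc]
      exact (summable_evolCoef hθ hb hc hs (k + 1)).mul_left _
    rw [hsm.tsum_eq_zero_add]
    simp only [hsucc]
    rw [tsum_mul_left]
    simp [g', evolCoef]
  rw [hsum] at key
  exact key

lemma shift_weight_bound {θ K b : ℝ} (hθ : 0 ≤ θ) {c : ℕ → ℂ}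
    (hc : ∀ k, ‖c k‖ ≤ K * b ^ k) (k : ℕ) :
    ‖((θ : ℂ) + k) * c (k + 1)‖ ≤ (θ + 1) * K * b * (2 * b) ^ k := by
  have hK : 0 ≤ K := by simpa using (norm_nonneg _).trans (hc 0)
  have h1 : ‖(θ : ℂ) + k‖ ≤ (θ + 1) * 2 ^ k := by
    refine (norm_add_le _ _).trans ?_
    rw [Complex.norm_real, Complex.norm_natCast, Real.norm_of_nonneg hθ]
    have h2 : (k : ℝ) ≤ 2 ^ k := by exact_mod_cast Nat.lt_two_pow_self.le
    have h3 : (1 : ℝ) ≤ 2 ^ k := one_le_pow₀ (by norm_num)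
    nlinarith
  rw [norm_mul]
  calc _ ≤ (θ + 1) * 2 ^ k * (K * b ^ (k + 1)) := by
        have := hc (k + 1)
        gcongr
    _ = _ := by rw [mul_pow]; ring

/-- The evolved function solves `∂u/∂s = Δ_θ u`. -/
lemma hasDerivAt_egf_evolCoef {θ K b s : ℝ} (hθ : 0 ≤ θ) (hb : 0 < b) {c : ℕ → ℂ}
    (hc : ∀ k, ‖c k‖ ≤ K * b ^ k) (hs : b * |s| < 1) (z : ℂ) :
    HasDerivAt (fun r : ℝ => egf (evolCoef θ r c) z)
      (deltaOp θ (egf (evolCoef θ s c)) z) s := by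
  obtain ⟨S, hsS, hS1⟩ : ∃ S, |s| < S ∧ S < 1 / b :=
    exists_between ((lt_div_iff₀ hb).2 (by linarith))
  have hbS : b * S < 1 := by rw [lt_div_iff₀ hb] at hS1; linarith
  have hmem : s ∈ Metric.ball (0 : ℝ) S := by simpa using hsS
  have hbd : ∀ r ∈ Metric.ball (0 : ℝ) S, ∀ k, ‖evolCoef θ r c k‖ ≤
      K / (1 - b * S) ^ (⌈θ⌉₊ + 1) * (b / (1 - b * S)) ^ k := fun r hr k =>
    norm_evolCoef_le hθ hb hc (by simpa using (mem_ball_zero_iff.1 hr).le) hbS k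
  have key := hasDerivAt_tsum_of_isPreconnected
    (g := fun k (r : ℝ) => evolCoef θ r c k * (z ^ k / (k ! : ℂ)))
    (g' := fun k (r : ℝ) => (((θ : ℂ) + k) * evolCoef θ r c (k + 1)) * (z ^ k / (k ! : ℂ)))
    (summable_pow_div_factorial_mul _ _ ‖z‖)
    Metric.isOpen_ball (convex_ball (0 : ℝ) S).isPreconnected (fun k r hr => by
      refine (hasDerivAt_evolCoef hθ hb hc ?_ k).mul_const _
      have : |r| < S := by simpa using mem_ball_zero_iff.1 hr
      exact (mul_lt_mul_of_pos_left this hb).trans hbS)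
    (fun k r hr => norm_egf_term_le (c := fun k => ((θ : ℂ) + k) * evolCoef θ r c (k + 1))
      (shift_weight_bound hθ (hbd r hr)) z k) hmem (summable_egf (hbd s hmem) z) hmem
  rw [deltaOp_egf θ (hbd s hmem) z]
  exact key

/-! ### Limits of polynomials with real nonpositive zeros -/

/-- The operator `Δ_θ = θ D + X D²` on real polynomials. -/
def polyDelta (θ : ℝ) : Module.End ℝ (Polynomial ℝ) :=
  θ • Polynomial.derivative +
    (LinearMap.mulLeft ℝ Polynomial.X) * (Polynomial.derivative * Polynomial.derivative)

lemma polyDelta_apply (θ : ℝ) (P : Polynomial ℝ) : polyDelta θ P =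
    Polynomial.C θ * P.derivative + Polynomial.X * P.derivative.derivative := by
  simp [polyDelta, Polynomial.smul_eq_C_mul]

/-- The `k`-th derivative at the origin, that is, the coefficient with respect to `X^k / k!`. -/
def egfCoeff (P : Polynomial ℝ) (k : ℕ) : ℝ := (k ! : ℝ) * P.coeff k

lemma egfCoeff_polyDelta (θ : ℝ) (P : Polynomial ℝ) (k : ℕ) :
    egfCoeff (polyDelta θ P) k = (θ + k) * egfCoeff P (k + 1) := by
  have h : (Polynomial.X * P.derivative.derivative).coeff k
      = k * ((k + 1 : ℝ) * P.coeff (k + 1)) := by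
    cases k with
    | zero => simp
    | succ k =>
      rw [Polynomial.coeff_X_mul, Polynomial.coeff_derivative, Polynomial.coeff_derivative]
      push_cast
      ring
  rw [polyDelta_apply, egfCoeff, egfCoeff, Polynomial.coeff_add, h, Polynomial.coeff_C_mul,
    Polynomial.coeff_derivative, Nat.factorial_succ]
  push_cast
  ring

lemma egfCoeff_polyDelta_pow (θ : ℝ) (m : ℕ) : ∀ (P : Polynomial ℝ) (k : ℕ),
    egfCoeff ((polyDelta θ ^ m) P) k = rising (θ + k) m * egfCoeff P (k + m) := by
  induction m with
  | zero => intro P k; simp [rising_zero]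
  | succ m ih =>
    intro P k
    rw [pow_succ', Module.End.mul_apply, egfCoeff_polyDelta, ih, rising_succ]
    rw [show k + 1 + m = k + (m + 1) by ring]
    push_cast
    ring_nf

/-- The Euler approximation `(1 + (s/N) Δ_θ)^N` of `exp(s Δ_θ)`; it is the identity for `N = 0`. -/
def eulerStep (θ s : ℝ) (N : ℕ) : Module.End ℝ (Polynomial ℝ) :=
  ((s / N) • polyDelta θ + 1) ^ N

lemma egfCoeff_nonneg {P : Polynomial ℝ} (hP : ∀ k, 0 ≤ P.coeff k) (k : ℕ) : 0 ≤ egfCoeff P k :=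
  mul_nonneg (by positivity) (hP k)

lemma egfCoeff_smul (r : ℝ) (P : Polynomial ℝ) (k : ℕ) :
    egfCoeff (r • P) k = r * egfCoeff P k := by
  simp [egfCoeff]; ring

lemma egfCoeff_sum {ι : Type*} (t : Finset ι) (P : ι → Polynomial ℝ) (k : ℕ) :
    egfCoeff (∑ i ∈ t, P i) k = ∑ i ∈ t, egfCoeff (P i) k := by
  simp [egfCoeff, Finset.mul_sum]

lemma egfCoeff_eulerStep (θ s : ℝ) (N : ℕ) (P : Polynomial ℝ) (k : ℕ) :
    egfCoeff (eulerStep θ s N P) k =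
      ∑' m : ℕ, ((N.choose m : ℝ) * (s / N) ^ m * rising (θ + k) m) * egfCoeff P (k + m) := by
  rw [tsum_eq_sum (s := Finset.range (N + 1))]
  · rw [eulerStep, (Commute.one_right ((s / (N : ℝ)) • polyDelta θ)).add_pow,
      LinearMap.sum_apply, egfCoeff_sum]
    refine Finset.sum_congr rfl fun m _ => ?_
    rw [one_pow, mul_one, smul_pow, Module.End.mul_apply, ← nsmul_one (N.choose m),
      LinearMap.smul_apply, LinearMap.smul_apply, Module.End.one_apply, map_nsmul,
      ← Nat.cast_smul_eq_nsmul ℝ, egfCoeff_smul, egfCoeff_smul, egfCoeff_polyDelta_pow]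
    ring
  · intro m hm
    rw [Nat.choose_eq_zero_of_lt (by simpa using hm)]
    simp

lemma eulerStep_coeff_nonneg {θ s : ℝ} (hθ : 0 ≤ θ) (hs : 0 ≤ s) (N : ℕ) {P : Polynomial ℝ}
    (hP : ∀ k, 0 ≤ P.coeff k) (k : ℕ) : 0 ≤ (eulerStep θ s N P).coeff k := by
  have h : 0 ≤ egfCoeff (eulerStep θ s N P) k := by
    rw [egfCoeff_eulerStep]
    refine tsum_nonneg fun m => ?_
    have := rising_nonneg (x := θ + k) (by positivity) m
    have := egfCoeff_nonneg hP (k + m)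
    positivity
  exact (mul_nonneg_iff_of_pos_left (by positivity)).1 h

lemma eulerStep_zeroFreeSlit {θ s : ℝ} (hθ : 0 ≤ θ) (hs : 0 ≤ s) (N : ℕ) {P : Polynomial ℝ}
    (hP : ZeroFreeSlit (P.map (algebraMap ℝ ℂ))) :
    ZeroFreeSlit ((eulerStep θ s N P).map (algebraMap ℝ ℂ)) := by
  have hr : 0 ≤ s / N := by positivity
  unfold eulerStep
  generalize s / (N : ℝ) = r at hr
  induction N with
  | zero => simpa using hP
  | succ N ih =>
    rw [pow_succ', Module.End.mul_apply]
    have := ih.add_deltaOp hr hθ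
    convert this using 1
    simp [polyDelta_apply, Polynomial.smul_eq_C_mul]
    ring

lemma tendsto_choose_div_pow (m : ℕ) :
    Tendsto (fun N : ℕ => (N.choose m : ℝ) / (N : ℝ) ^ m) atTop (𝓝 (1 / (m ! : ℝ))) := by
  have h := isEquivalent_choose m
  have h2 : ∀ᶠ N : ℕ in atTop, ((N : ℝ) ^ m / (m ! : ℝ)) ≠ 0 := by
    filter_upwards [eventually_gt_atTop 0] with N hN
    positivity
  have h3 := (Asymptotics.isEquivalent_iff_tendsto_one h2).1 h
  have h4 := h3.mul_const (1 / (m ! : ℝ))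
  rw [one_mul] at h4
  refine h4.congr fun N => ?_
  have : (m ! : ℝ) ≠ 0 := by positivity
  simp only [Pi.div_apply]
  field_simp

lemma eulerStep_term_eq (θ s : ℝ) (N k m : ℕ) :
    (N.choose m : ℝ) * (s / N) ^ m * rising (θ + k) m
      = s ^ m * (((N.choose m : ℝ) / (N : ℝ) ^ m) * rising (θ + k) m) := by
  rw [div_pow]; ring

/-- The terms of the Euler approximation have the same majorant as those of the evolution, since
`binom(N, m) / N^m ≤ 1 / m!`. -/
lemma norm_eulerStep_term_le {θ s K b : ℝ} (hθ : 0 ≤ θ) (hs : 0 ≤ s) {P : Polynomial ℝ}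
    (hP : ∀ k, |egfCoeff P k| ≤ K * b ^ k) (N k m : ℕ) :
    ‖((N.choose m : ℝ) * (s / N) ^ m * rising (θ + k) m) * egfCoeff P (k + m)‖ ≤
      K * b ^ k * (((m + (⌈θ⌉₊ + k)).choose (⌈θ⌉₊ + k) : ℝ) * (b * s) ^ m) := by
  have hr := rising_nonneg (x := θ + k) (by positivity) m
  have h1 : (N.choose m : ℝ) / (N : ℝ) ^ m ≤ 1 / (m ! : ℝ) := by
    rcases Nat.eq_zero_or_pos N with rfl | hN
    · cases m <;> simp
    · rw [div_le_iff₀ (by positivity)]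
      have := Nat.choose_le_pow_div (α := ℝ) m N
      exact this.trans_eq (by ring)
  have h2 := norm_evolCoef_term_le (S := s) (s := s) hθ (c := fun k => (egfCoeff P k : ℂ))
    (K := K) (b := b) (fun k => by simpa using hP k) (abs_of_nonneg hs).le k m
  refine le_trans ?_ h2
  rw [eulerStep_term_eq, ← Complex.ofReal_mul, Complex.norm_real, norm_mul,
    norm_mul (s ^ m * (rising (θ + k) m / (m ! : ℝ))) (egfCoeff P (k + m))]
  refine mul_le_mul_of_nonneg_right ?_ (norm_nonneg (egfCoeff P (k + m)))
  rw [Real.norm_of_nonneg (by positivity), Real.norm_of_nonneg (by positivity)]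
  refine mul_le_mul_of_nonneg_left ?_ (by positivity)
  calc _ ≤ 1 / (m ! : ℝ) * rising (θ + k) m := mul_le_mul_of_nonneg_right h1 hr
    _ = _ := by ring

lemma aeval_eq_egf (P : Polynomial ℝ) (z : ℂ) :
    Polynomial.aeval z P = egf (fun k => (egfCoeff P k : ℂ)) z := by
  rw [egf, tsum_eq_sum (s := Finset.range (P.natDegree + 1)), Polynomial.aeval_eq_sum_range]
  · refine Finset.sum_congr rfl fun k _ => ?_
    have : (k ! : ℂ) ≠ 0 := by exact_mod_cast k.factorial_ne_zero
    rw [egfCoeff, Complex.real_smul]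
    push_cast
    field_simp
  · intro k hk
    rw [egfCoeff, Polynomial.coeff_eq_zero_of_natDegree_lt (by simpa using hk)]
    simp

lemma aeval_ofReal (P : Polynomial ℝ) (x : ℝ) :
    Polynomial.aeval (x : ℂ) P = ((P.eval x : ℝ) : ℂ) := by
  simpa using Polynomial.aeval_algebraMap_apply_eq_algebraMap_eval (A := ℂ) x P

/-- Dominated coefficientwise convergence gives pointwise convergence. -/
lemma tendsto_egf {K b : ℝ} {q : ℕ → ℕ → ℂ} {c : ℕ → ℂ} (hq : ∀ n k, ‖q n k‖ ≤ K * b ^ k)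
    (h : ∀ k, Tendsto (fun n => q n k) atTop (𝓝 (c k))) (z : ℂ) :
    Tendsto (fun n => egf (q n) z) atTop (𝓝 (egf c z)) :=
  tendsto_tsum_of_dominated_convergence (summable_pow_div_factorial_mul K b ‖z‖)
    (fun k => (h k).mul_const _)
    (Eventually.of_forall fun n k => norm_egf_term_le (hq n) z k)

/-- `f` is the pointwise limit of polynomials with nonnegative coefficients and with real
nonpositive zeros, which are uniformly of exponential type at most `a`, and `f(0) > 0`. As the
coefficients are nonnegative, the growth has to be controlled on the positive half-line only. -/
def LaguerreLimit (a : ℝ) (f : ℂ → ℂ) : Prop :=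
  (∃ P : ℕ → Polynomial ℝ, (∀ n k, 0 ≤ (P n).coeff k) ∧
    (∀ n, ZeroFreeSlit ((P n).map (algebraMap ℝ ℂ))) ∧
    (∀ b, a < b → ∃ K : ℝ, ∀ n, ∀ x : ℝ, 0 ≤ x → (P n).eval x ≤ K * Real.exp (b * x)) ∧
    ∀ z : ℂ, Tendsto (fun n => Polynomial.aeval z (P n)) atTop (𝓝 (f z))) ∧
  ∃ r : ℝ, 0 < r ∧ f 0 = r

lemma exists_egfCoeff_bound {a b : ℝ} (ha : 0 ≤ a) (hab : a < b) {P : ℕ → Polynomial ℝ}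
    (hP : ∀ n k, 0 ≤ (P n).coeff k)
    (h : ∀ b, a < b → ∃ K : ℝ, ∀ n, ∀ x : ℝ, 0 ≤ x → (P n).eval x ≤ K * Real.exp (b * x)) :
    ∃ K : ℝ, ∀ n k, |egfCoeff (P n) k| ≤ K * b ^ k := by
  obtain ⟨b₀, h0, h1⟩ := exists_between hab
  obtain ⟨K, hK⟩ := h b₀ h0
  obtain ⟨K', hK'⟩ := factorial_mul_le_of_growth (ha.trans h0.le) h1 K
  refine ⟨K', fun n k => ?_⟩
  rw [abs_of_nonneg (egfCoeff_nonneg (hP n) k)]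
  refine hK' k _ fun x hx => le_trans ?_ (hK n x hx)
  have hnn : ∀ i, 0 ≤ (P n).coeff i * x ^ i := fun i => mul_nonneg (hP n i) (by positivity)
  by_cases hk : k ∈ Finset.range ((P n).natDegree + 1)
  · rw [Polynomial.eval_eq_sum_range]
    exact Finset.single_le_sum (f := fun i => (P n).coeff i * x ^ i) (fun i _ => hnn i) hk
  · rw [Polynomial.coeff_eq_zero_of_natDegree_lt (by simpa using hk), zero_mul,
      Polynomial.eval_eq_sum_range]
    exact Finset.sum_nonneg fun i _ => hnn i

/-- After passing to a subsequence, the coefficients of the approximating polynomials converge. -/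
lemma LaguerreLimit.exists_coeff {a : ℝ} (ha : 0 ≤ a) {f : ℂ → ℂ} (hf : LaguerreLimit a f) :
    ∃ (P : ℕ → Polynomial ℝ) (c : ℕ → ℝ), (∀ n k, 0 ≤ (P n).coeff k) ∧
      (∀ n, ZeroFreeSlit ((P n).map (algebraMap ℝ ℂ))) ∧
      (∀ b, a < b → ∃ K : ℝ, ∀ n k, |egfCoeff (P n) k| ≤ K * b ^ k) ∧
      (∀ k, Tendsto (fun n => egfCoeff (P n) k) atTop (𝓝 (c k))) ∧
      (∀ b, a < b → ∃ K : ℝ, ∀ k, ‖(c k : ℂ)‖ ≤ K * b ^ k) ∧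
      (∀ k, 0 ≤ c k) ∧ 0 < c 0 ∧ f = egf (fun k => (c k : ℂ)) := by
  obtain ⟨⟨P, hP, hroot, hgr, hlim⟩, r, hr, hfr⟩ := hf
  have hbd := fun b (hb : a < b) => exists_egfCoeff_bound ha hb hP hgr
  obtain ⟨K₁, hK₁⟩ := hbd (a + 1) (by linarith)
  have hcomp : IsCompact (Set.univ.pi fun k : ℕ => Icc (0 : ℝ) (K₁ * (a + 1) ^ k)) :=
    isCompact_univ_pi fun _ => isCompact_Icc
  obtain ⟨c, -, ι, hι, hc⟩ := hcomp.tendsto_subseq (x := fun n k => egfCoeff (P n) k)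
    (fun n k _ => ⟨egfCoeff_nonneg (hP n) k, (le_abs_self _).trans (hK₁ n k)⟩)
  have hc' : ∀ k, Tendsto (fun n => egfCoeff (P (ι n)) k) atTop (𝓝 (c k)) :=
    fun k => (tendsto_pi_nhds.1 hc) k
  have hf : f = egf (fun k => (c k : ℂ)) := by
    funext z
    refine tendsto_nhds_unique ((hlim z).comp hι.tendsto_atTop) ?_
    have := tendsto_egf (q := fun n k => (egfCoeff (P (ι n)) k : ℂ)) (K := K₁) (b := a + 1)
      (fun n k => by simpa using hK₁ (ι n) k)
      (fun k => (Complex.continuous_ofReal.tendsto _).comp (hc' k)) z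
    refine this.congr fun n => ?_
    rw [Function.comp_apply, aeval_eq_egf]
  have hc0 : c 0 = r := by
    have := congrFun hf 0
    rw [egf_zero, hfr] at this
    exact_mod_cast this.symm
  refine ⟨fun n => P (ι n), c, fun n => hP _, fun n => hroot _, fun b hb => ?_, hc', fun b hb => ?_,
    fun k => ?_, hc0 ▸ hr, hf⟩
  · obtain ⟨K, hK⟩ := hbd b hb
    exact ⟨K, fun n => hK _⟩
  · obtain ⟨K, hK⟩ := hbd b hb
    refine ⟨K, fun k => ?_⟩
    rw [Complex.norm_real]
    exact le_of_tendsto (hc' k).norm (Eventually.of_forall fun n => hK (ι n) k)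
  · exact ge_of_tendsto (hc' k)
      (Eventually.of_forall fun n => egfCoeff_nonneg (hP (ι n)) k)

lemma LaguerreLimit.mem_spaceA {a : ℝ} (ha : 0 ≤ a) {f : ℂ → ℂ} (hf : LaguerreLimit a f) :
    f ∈ spaceA a := by
  obtain ⟨P, c, -, -, -, -, hc, -, -, rfl⟩ := hf.exists_coeff ha
  exact egf_mem_spaceA ha hc

/-- The evolution `exp(s Δ_θ) f`, defined through the Taylor coefficients of `f` at the origin. -/
def evol (θ s : ℝ) (f : ℂ → ℂ) : ℂ → ℂ :=
  egf (evolCoef θ s fun k => iteratedDeriv k f 0)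

lemma evolCoef_ofReal (θ s : ℝ) (c : ℕ → ℝ) (k : ℕ) :
    evolCoef θ s (fun k => (c k : ℂ)) k =
      ((∑' m : ℕ, (s ^ m * (rising (θ + k) m / (m ! : ℝ))) * c (k + m) : ℝ) : ℂ) := by
  rw [evolCoef, Complex.ofReal_tsum]
  simp only [Complex.ofReal_mul]

/-- The evolution for time `s ≥ 0` preserves limits of polynomials with real nonpositive zeros, and
turns type `a` into type `a / (1 - a s)`. -/
lemma LaguerreLimit.evol {a a' s θ : ℝ} (ha : 0 ≤ a) (hθ : 0 ≤ θ) (hs : 0 ≤ s) (has : a * s < 1)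
    (ha' : a ≤ a' * (1 - a * s)) {f : ℂ → ℂ} (hf : LaguerreLimit a f) :
    LaguerreLimit a' (evol θ s f) := by
  obtain ⟨P, c, hP, hroot, hbd, hlim, hcbd, hcnn, hc0, rfl⟩ := hf.exists_coeff ha
  have ha'0 : 0 ≤ a' := by
    by_contra hcon
    nlinarith
  have hcoef : (fun k => iteratedDeriv k (egf fun k => (c k : ℂ)) 0) = fun k => (c k : ℂ) := by
    obtain ⟨K, hK⟩ := hcbd (a + 1) (by linarith)
    funext k
    exact iteratedDeriv_egf_zero hK k
  rw [LaguerreEvolution.evol, hcoef]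
  -- `b = b' / (1 + b' s)` is the type that the evolution turns into `b'`
  have hb' : ∀ b', a' < b' → a < b' / (1 + b' * s) ∧ b' / (1 + b' * s) * s < 1 ∧
      b' / (1 + b' * s) / (1 - b' / (1 + b' * s) * s) = b' := by
    intro b' hb'
    have h0 : 0 < b' := ha'0.trans_lt hb'
    have h1 : 0 < 1 + b' * s := by positivity
    refine ⟨?_, ?_, ?_⟩
    · rw [lt_div_iff₀ h1]
      nlinarith [mul_lt_mul_of_pos_right hb' (sub_pos.2 has)]
    · rw [div_mul_eq_mul_div, div_lt_one h1]; linarith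
    · have : 1 - b' / (1 + b' * s) * s = 1 / (1 + b' * s) := by field_simp; ring
      rw [this]; field_simp
  let Q : ℕ → Polynomial ℝ := fun n => eulerStep θ s n (P n)
  have hQnn : ∀ n k, 0 ≤ (Q n).coeff k := fun n => eulerStep_coeff_nonneg hθ hs n (hP n)
  have hQbd : ∀ b', a' < b' → ∃ K : ℝ, ∀ n k, ‖(egfCoeff (Q n) k : ℂ)‖ ≤ K * b' ^ k := by
    intro b' hlt
    obtain ⟨h1, h2, h3⟩ := hb' b' hlt
    obtain ⟨K, hK⟩ := hbd _ h1
    generalize b' / (1 + b' * s) = b at h1 h2 h3 hK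
    have hb : 0 ≤ b := ha.trans h1.le
    refine ⟨K / (1 - b * s) ^ (⌈θ⌉₊ + 1), fun n k => ?_⟩
    rw [← h3, Complex.norm_real, egfCoeff_eulerStep]
    refine (tsum_of_norm_bounded
      (hasSum_evolBound (by positivity) h2 (K * b ^ k) (⌈θ⌉₊ + k))
      (norm_eulerStep_term_le hθ hs (hK n) n k)).trans_eq ?_
    rw [div_pow, show ⌈θ⌉₊ + k + 1 = ⌈θ⌉₊ + 1 + k by ring, pow_add (1 - b * s)]
    have : 0 < 1 - b * s := by linarith
    field_simp
  refine ⟨⟨Q, hQnn, fun n => eulerStep_zeroFreeSlit hθ hs n (hroot n), fun b' hlt => ?_,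
    fun z => ?_⟩, ?_⟩
  · obtain ⟨K, hK⟩ := hQbd b' hlt
    refine ⟨K, fun n x hx => ?_⟩
    have h1 := norm_egf_le (hK n) (x : ℂ)
    rw [← aeval_eq_egf, Complex.norm_real, Real.norm_of_nonneg hx] at h1
    refine le_trans ?_ h1
    rw [aeval_ofReal, Complex.norm_real]
    exact Real.le_norm_self _
  · obtain ⟨h1, h2, h3⟩ := hb' (a' + 1) (by linarith)
    obtain ⟨K, hK⟩ := hbd _ h1
    generalize (a' + 1) / (1 + (a' + 1) * s) = b at h1 h2 h3 hK
    have hb : 0 ≤ b := ha.trans h1.le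
    obtain ⟨K', hK'⟩ := hQbd (a' + 1) (by linarith)
    simp only [aeval_eq_egf]
    refine tendsto_egf hK' (fun k => ?_) z
    rw [evolCoef_ofReal]
    refine (Complex.continuous_ofReal.tendsto _).comp ?_
    simp only [Q, egfCoeff_eulerStep]
    refine tendsto_tsum_of_dominated_convergence
      (hasSum_evolBound (by positivity) h2 (K * b ^ k) (⌈θ⌉₊ + k)).summable (fun m => ?_)
      (Eventually.of_forall fun n m => norm_eulerStep_term_le hθ hs (hK n) n k m)
    simp only [eulerStep_term_eq]
    refine Tendsto.mul ?_ (hlim (k + m))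
    refine Tendsto.const_mul _ ?_
    have := (tendsto_choose_div_pow m).mul_const (rising (θ + k) m)
    rwa [one_div_mul_eq_div] at this
  · obtain ⟨h1, h2, h3⟩ := hb' (a' + 1) (by linarith)
    obtain ⟨K, hK⟩ := hcbd _ h1
    generalize (a' + 1) / (1 + (a' + 1) * s) = b at h1 h2 h3 hK
    have hb : 0 < b := ha.trans_lt h1
    have hsum := summable_evolCoef (s := s) hθ hb hK (by rwa [abs_of_nonneg hs]) 0
    simp only [← Complex.ofReal_mul] at hsum
    have hsum' := Complex.summable_ofReal.1 hsum
    refine ⟨_, ?_, (egf_zero _).trans (evolCoef_ofReal θ s c 0)⟩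
    refine lt_of_lt_of_le ?_ (hsum'.le_tsum 0 fun n _ => ?_)
    · simpa [rising_zero] using hc0
    · have := rising_nonneg (x := θ + (0 : ℕ)) (by simpa using hθ) n
      have := hcnn (0 + n)
      positivity

/-! ### The limits of such polynomials are Laguerre entire functions -/

lemma list_prod_map_eq_prod_range {M : Type*} [CommMonoid M] (f : ℝ → M) (l : List ℝ) :
    (l.map f).prod = ∏ j ∈ Finset.range l.length, f (l.getD j 0) := by
  induction l with
  | nil => simp
  | cons a l ih => rw [List.map_cons, List.prod_cons, ih, List.length_cons,
      Finset.prod_range_succ', mul_comm]; simp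

lemma getD_nonneg {l : List ℝ} (h0 : ∀ x ∈ l, 0 ≤ x) (j : ℕ) : 0 ≤ l.getD j 0 := by
  by_cases hj : j < l.length
  · rw [List.getD_eq_getElem _ _ hj]; exact h0 _ (List.getElem_mem hj)
  · rw [List.getD_eq_default _ _ (not_lt.1 hj)]

lemma antitone_getD_of_pairwise {l : List ℝ} (hl : l.Pairwise (· ≥ ·)) (h0 : ∀ x ∈ l, 0 ≤ x) :
    Antitone fun j => l.getD j 0 := by
  intro i j hij
  rcases eq_or_lt_of_le hij with rfl | hlt
  · exact le_rfl
  by_cases hj : j < l.length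
  · have hi : i < l.length := hlt.trans hj
    simp only
    rw [List.getD_eq_getElem _ _ hj, List.getD_eq_getElem _ _ hi]
    exact List.pairwise_iff_getElem.1 hl i j hi hj hlt
  · simp only
    rw [List.getD_eq_default _ _ (not_lt.1 hj)]
    exact getD_nonneg h0 i

lemma coeff_one_prod_one_add (γ : ℕ → ℝ) (d : ℕ) :
    (∏ j ∈ Finset.range d, (1 + Polynomial.C (γ j) * Polynomial.X)).coeff 0 = 1 ∧
    (∏ j ∈ Finset.range d, (1 + Polynomial.C (γ j) * Polynomial.X)).coeff 1
      = ∑ j ∈ Finset.range d, γ j := by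
  induction d with
  | zero => simp [Polynomial.coeff_one]
  | succ d ih =>
    rw [Finset.prod_range_succ, Finset.sum_range_succ, mul_add, mul_one]
    constructor
    · rw [Polynomial.coeff_add, ih.1]; simp
    · rw [Polynomial.coeff_add, ih.2, ← mul_assoc, Polynomial.coeff_mul_X, Polynomial.coeff_mul_C,
        ih.1, one_mul]

/-- A real polynomial with real nonpositive zeros and nonzero constant term is a multiple of
`∏ (1 + γ_j X)`, where the `γ_j ≥ 0` are arranged in decreasing order. -/
lemma exists_factorization {P : Polynomial ℝ} (hP : ZeroFreeSlit (P.map (algebraMap ℝ ℂ)))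
    (h0 : P.coeff 0 ≠ 0) : ∃ (γ : ℕ → ℝ) (d : ℕ), Antitone γ ∧ (∀ j, 0 ≤ γ j) ∧
      (∀ j, d ≤ j → γ j = 0) ∧
      P = Polynomial.C (P.coeff 0) *
        ∏ j ∈ Finset.range d, (1 + Polynomial.C (γ j) * Polynomial.X) := by
  set PC := P.map (algebraMap ℝ ℂ) with hPC
  have hPC0 : PC.eval 0 = (P.coeff 0 : ℂ) := by
    rw [hPC, ← Polynomial.coeff_zero_eq_eval_zero, Polynomial.coeff_map]; rfl
  have hPC0' : PC.eval 0 ≠ 0 := by rw [hPC0]; exact_mod_cast h0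
  have hroot : ∀ r ∈ PC.roots, ∃ g : ℝ, 0 ≤ g ∧ r ≠ 0 ∧ r⁻¹ = -(g : ℂ) := by
    intro r hr
    have hr0 : PC.eval r = 0 := (Polynomial.mem_roots'.1 hr).2
    have hrs : r.re ≤ 0 ∧ r.im = 0 := not_mem_slitPlane_iff.1 fun h => hP r h hr0
    obtain ⟨ρ, rfl⟩ : ∃ ρ : ℝ, r = ρ := ⟨r.re, Complex.ext (by simp) (by simp [hrs.2])⟩
    rw [Complex.ofReal_re] at hrs
    refine ⟨-ρ⁻¹, by simpa using hrs.1, ?_, by simp⟩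
    intro h
    rw [h] at hr0
    exact hPC0' hr0
  -- the `γ_j` are the negatives of the inverse zeros
  let G : Multiset ℝ := PC.roots.map fun r => -(r⁻¹).re
  let l := G.sort (· ≥ ·)
  have hl0 : ∀ x ∈ l, 0 ≤ x := by
    intro x hx
    rw [Multiset.mem_sort] at hx
    obtain ⟨r, hr, rfl⟩ := Multiset.mem_map.1 hx
    obtain ⟨g, hg, -, h⟩ := hroot r hr
    rw [h]; simpa using hg
  have heval : ∀ z : ℂ, PC.eval z = PC.eval 0 *
      ∏ j ∈ Finset.range l.length, (1 + ((l.getD j 0 : ℝ) : ℂ) * z) := by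
    intro z
    have h1 : (PC.roots.map (z - ·)).prod = (PC.roots.map (0 - ·)).prod *
        (PC.roots.map fun r => 1 + ((-(r⁻¹).re : ℝ) : ℂ) * z).prod := by
      rw [← Multiset.prod_map_mul]
      congr 1
      refine Multiset.map_congr rfl fun r hr => ?_
      obtain ⟨g, hg, hr0, h⟩ := hroot r hr
      have h2 : ((-(r⁻¹).re : ℝ) : ℂ) = -r⁻¹ := by rw [h]; simp
      rw [h2]
      field_simp
      ring
    have h3 := list_prod_map_eq_prod_range (fun g : ℝ => 1 + (g : ℂ) * z) l
    rw [← h3, ← Multiset.prod_coe, ← Multiset.map_coe, Multiset.sort_eq, Multiset.map_map,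
      (IsAlgClosed.splits PC).eval_eq_prod_roots z, (IsAlgClosed.splits PC).eval_eq_prod_roots 0,
      h1, mul_assoc]
    rfl
  refine ⟨fun j => l.getD j 0, l.length,
    antitone_getD_of_pairwise (Multiset.pairwise_sort _ _) hl0, getD_nonneg hl0,
    fun j hj => List.getD_eq_default _ _ hj, ?_⟩
  · refine Polynomial.funext fun x => ?_
    have h := heval (x : ℂ)
    rw [hPC0] at h
    have h4 : PC.eval (x : ℂ) = ((P.eval x : ℝ) : ℂ) := by
      rw [hPC, Polynomial.eval_map_algebraMap, aeval_ofReal]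
    rw [h4] at h
    rw [Polynomial.eval_mul, Polynomial.eval_C, Polynomial.eval_prod]
    simp only [Polynomial.eval_add, Polynomial.eval_one, Polynomial.eval_mul, Polynomial.eval_C,
      Polynomial.eval_X]
    exact_mod_cast h

/-- The deviation from `1` of the Weierstrass factor `(1 + w) e^{-w}`. -/
def weierstrass (w : ℂ) : ℂ := (1 + w) * Complex.exp (-w) - 1

lemma norm_weierstrass_le {w : ℂ} {ρ : ℝ} (hw : ‖w‖ ≤ ρ) :
    ‖weierstrass w‖ ≤ ((1 + ρ) * Real.exp ρ + 1) * ‖w‖ ^ 2 := by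
  have h1 := Complex.norm_exp_sub_sum_le_norm_mul_exp (-w) 2
  simp [Finset.sum_range_succ] at h1
  have h2 : weierstrass w = (1 + w) * (Complex.exp (-w) - (1 + -w)) - w ^ 2 := by
    unfold weierstrass; ring
  rw [h2]
  refine (norm_sub_le _ _).trans ?_
  rw [norm_mul, norm_pow, add_mul, one_mul]
  refine add_le_add ?_ le_rfl
  have h3 : ‖1 + w‖ ≤ 1 + ρ := (norm_add_le _ _).trans (by simpa using hw)
  have h4 : Real.exp ‖w‖ ≤ Real.exp ρ := Real.exp_le_exp.2 hw
  calc ‖1 + w‖ * ‖Complex.exp (-w) - (1 + -w)‖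
      ≤ (1 + ρ) * (‖w‖ ^ 2 * Real.exp ρ) := by
        refine mul_le_mul h3 (le_trans ?_ (mul_le_mul_of_nonneg_left h4 (by positivity)))
          (norm_nonneg _) ((norm_nonneg _).trans h3)
        simpa using h1
    _ = _ := by ring

lemma norm_weierstrass_mul_le {S g : ℝ} {j : ℕ} (hg : 0 ≤ g) (hgS : g ≤ S / (j + 1)) (z : ℂ) :
    ‖weierstrass (g * z)‖ ≤ ((1 + S * ‖z‖) * Real.exp (S * ‖z‖) + 1) * (S * ‖z‖) ^ 2 *
      (1 / ((j : ℝ) + 1) ^ 2) := by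
  have hj : (0 : ℝ) < j + 1 := by positivity
  have hS : 0 ≤ S := by
    have := hg.trans hgS
    rw [le_div_iff₀ hj] at this
    simpa using this
  have hn : ‖(g : ℂ) * z‖ = g * ‖z‖ := by rw [norm_mul, Complex.norm_real, Real.norm_of_nonneg hg]
  have h1 : ‖(g : ℂ) * z‖ ≤ S * ‖z‖ / (j + 1) := by
    rw [hn, mul_div_right_comm]
    exact mul_le_mul_of_nonneg_right hgS (norm_nonneg _)
  have h2 : S * ‖z‖ / (j + 1) ≤ S * ‖z‖ :=
    div_le_self (by positivity) (by linarith [(Nat.cast_nonneg j : (0 : ℝ) ≤ j)])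
  refine (norm_weierstrass_le (h1.trans h2)).trans ?_
  calc _ ≤ ((1 + S * ‖z‖) * Real.exp (S * ‖z‖) + 1) * (S * ‖z‖ / (j + 1)) ^ 2 := by gcongr
    _ = _ := by rw [div_pow]; ring

lemma summable_weierstrass_bound (A : ℝ) :
    Summable fun j : ℕ => A * (1 / ((j : ℝ) + 1) ^ 2) := by
  have h := (summable_nat_add_iff 1).2 (Real.summable_one_div_nat_pow.2 (one_lt_two))
  refine Summable.mul_left A (h.congr fun j => ?_)
  push_cast
  rfl

lemma le_sum_div_of_antitone {γ : ℕ → ℝ} (hγ : Antitone γ) (h0 : ∀ j, 0 ≤ γ j) {S : ℝ}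
    (hS : HasSum γ S) (j : ℕ) : γ j ≤ S / (j + 1) := by
  rw [le_div_iff₀ (by positivity)]
  calc γ j * (j + 1) = ∑ i ∈ Finset.range (j + 1), γ j := by simp; ring
    _ ≤ ∑ i ∈ Finset.range (j + 1), γ i :=
        Finset.sum_le_sum fun i hi => hγ (by simpa [Nat.lt_succ_iff] using hi)
    _ ≤ S := sum_le_hasSum _ (fun i _ => h0 i) hS

/-- The factors `e^{γ_j z}`, whose product is not continuous under termwise convergence of `γ`, are
split off from the product; what remains is dominated by `∑ 1 / (j + 1)²`. -/
lemma tprod_one_add_mul_eq {γ : ℕ → ℝ} (hγ : Antitone γ) (h0 : ∀ j, 0 ≤ γ j) {S : ℝ}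
    (hS : HasSum γ S) (z : ℂ) : ∏' j, (1 + (γ j : ℂ) * z) =
      Complex.exp (S * z) * ∏' j, (1 + weierstrass (γ j * z)) := by
  have h1 : HasProd (fun j => Complex.exp ((γ j : ℂ) * z)) (Complex.exp (S * z)) := by
    have h2 : HasSum (fun j => (γ j : ℂ) * z) (S * z) :=
      (Complex.hasSum_ofReal.2 hS).mul_right z
    have h3 := (Complex.continuous_exp.tendsto _).comp h2
    refine h3.congr fun s => ?_
    simp [Complex.exp_sum]
  have h4 : Multipliable fun j => 1 + weierstrass (γ j * z) := by
    refine multipliable_one_add_of_summable (Summable.of_nonneg_of_le (fun _ => norm_nonneg _)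
      (fun j => norm_weierstrass_mul_le (h0 j) (le_sum_div_of_antitone hγ h0 hS j) z)
      (summable_weierstrass_bound _))
  rw [← h1.tprod_eq, ← h1.multipliable.tprod_mul h4]
  congr 1
  funext j
  rw [weierstrass, Complex.exp_neg]
  field_simp [Complex.exp_ne_zero]
  ring

/-- The zeros of the approximating polynomials, suitably normalised and arranged, converge along a
subsequence. The mass that their sum loses in the limit is the exponential type `α`. -/
theorem LaguerreLimit.mem_laguerre {a : ℝ} (ha : 0 ≤ a) {f : ℂ → ℂ} (hf : LaguerreLimit a f) :
    f ∈ laguerre := by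
  obtain ⟨P, c, hP, hroot, hbd, hlim, hcbd, hcnn, hc0, rfl⟩ := hf.exists_coeff ha
  have hlim0 : Tendsto (fun n => (P n).coeff 0) atTop (𝓝 (c 0)) := by
    simpa [egfCoeff] using hlim 0
  have hlim1 : Tendsto (fun n => (P n).coeff 1) atTop (𝓝 (c 1)) := by
    simpa [egfCoeff] using hlim 1
  -- the first `N` polynomials, whose constant term may vanish, are discarded
  obtain ⟨N, hN⟩ := eventually_atTop.1 (hlim0.eventually_const_lt (half_lt_self hc0))
  have hpos : ∀ n, 0 < (P (n + N)).coeff 0 := fun n =>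
    (half_pos hc0).trans (hN (n + N) (by omega))
  choose γ d hanti hnn hzero hfac using fun n =>
    exists_factorization (hroot (n + N)) (hpos n).ne'
  let S : ℕ → ℝ := fun n => ∑ j ∈ Finset.range (d n), γ n j
  have hsum : ∀ n, HasSum (γ n) (S n) := fun n =>
    hasSum_sum_of_ne_finset_zero fun j hj => hzero n j (by simpa using hj)
  have hSeq : ∀ n, S n = (P (n + N)).coeff 1 / (P (n + N)).coeff 0 := by
    intro n
    rw [eq_div_iff (hpos n).ne']
    conv_rhs => rw [hfac n]
    rw [Polynomial.coeff_C_mul, (coeff_one_prod_one_add (γ n) (d n)).2, mul_comm]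
  have hSlim : Tendsto S atTop (𝓝 (c 1 / c 0)) := by
    have h := ((hlim1.comp (tendsto_add_atTop_nat N)).div
      (hlim0.comp (tendsto_add_atTop_nat N)) hc0.ne')
    refine h.congr fun n => ?_
    simp [hSeq]
  set L := c 1 / c 0
  obtain ⟨M, hM⟩ := hSlim.bddAbove_range
  have hSM : ∀ n, S n ≤ M := fun n => hM ⟨n, rfl⟩
  have hγM : ∀ n j, γ n j ≤ M / (j + 1) := fun n j =>
    (le_sum_div_of_antitone (hanti n) (hnn n) (hsum n) j).trans (by gcongr; exact hSM n)
  have hcomp : IsCompact (Set.univ.pi fun j : ℕ => Icc (0 : ℝ) (M / (j + 1))) :=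
    isCompact_univ_pi fun _ => isCompact_Icc
  obtain ⟨g, -, ι, hι, hg⟩ := hcomp.tendsto_subseq (x := γ)
    (fun n j _ => ⟨hnn n j, hγM n j⟩)
  have hg' : ∀ j, Tendsto (fun n => γ (ι n) j) atTop (𝓝 (g j)) :=
    fun j => (tendsto_pi_nhds.1 hg) j
  have hSι : Tendsto (fun n => S (ι n)) atTop (𝓝 L) := hSlim.comp hι.tendsto_atTop
  have hg0 : ∀ j, 0 ≤ g j := fun j =>
    ge_of_tendsto (hg' j) (Eventually.of_forall fun n => hnn (ι n) j)
  have hganti : Antitone g := fun i j hij =>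
    le_of_tendsto_of_tendsto' (hg' j) (hg' i) fun n => hanti (ι n) hij
  have hpartial : ∀ m, ∑ j ∈ Finset.range m, g j ≤ L := fun m =>
    le_of_tendsto_of_tendsto' (tendsto_finsetSum _ fun j _ => hg' j) hSι
      fun n => sum_le_hasSum _ (fun j _ => hnn (ι n) j) (hsum (ι n))
  have hgsum : Summable g := summable_of_sum_range_le hg0 hpartial
  -- by Fatou's lemma `∑ γ_j ≤ L`, and `α` is the difference
  have hgle : ∑' j, g j ≤ L := hgsum.tsum_le_of_sum_range_le hpartial
  refine ⟨c 0, 0, L - ∑' j, g j, g, by linarith, hg0, hganti, hgsum, fun z => ?_⟩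
  have hprod : Tendsto (fun n => ∏' j, (1 + weierstrass (γ (ι n) j * z))) atTop
      (𝓝 (∏' j, (1 + weierstrass (g j * z)))) := by
    refine tendsto_tprod_one_add_of_dominated_convergence (summable_weierstrass_bound _)
      (fun j => ?_) (Eventually.of_forall fun n j =>
        norm_weierstrass_mul_le (hnn (ι n) j) (hγM (ι n) j) z)
    have hcont : Continuous fun r : ℝ => weierstrass (r * z) := by unfold weierstrass; fun_prop
    exact (hcont.tendsto _).comp (hg' j)
  have hval : ∀ n, Polynomial.aeval z (P (n + N)) = ((P (n + N)).coeff 0 : ℂ) *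
      (Complex.exp (S n * z) * ∏' j, (1 + weierstrass (γ n j * z))) := by
    intro n
    rw [← tprod_one_add_mul_eq (hanti n) (hnn n) (hsum n) z,
      tprod_eq_prod (s := Finset.range (d n)) (fun j hj => by
        rw [hzero n j (by simpa using hj)]; simp)]
    conv_lhs => rw [hfac n]
    simp [map_prod]
  have hlimz : Tendsto (fun n => Polynomial.aeval z (P (ι n + N))) atTop
      (𝓝 (egf (fun k => (c k : ℂ)) z)) := by
    obtain ⟨K, hK⟩ := hbd (a + 1) (by linarith)
    simp only [aeval_eq_egf]
    refine tendsto_egf (K := K) (b := a + 1) (fun n k => by simpa using hK (ι n + N) k)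
      (fun k => (Complex.continuous_ofReal.tendsto _).comp ?_) z
    exact (hlim k).comp ((tendsto_add_atTop_nat N).comp hι.tendsto_atTop)
  refine (tendsto_nhds_unique (b := (c 0 : ℂ) * (Complex.exp (L * z) *
    ∏' j, (1 + weierstrass (g j * z)))) hlimz ?_).trans ?_
  · simp only [hval]
    refine Tendsto.mul ?_ (Tendsto.mul ?_ hprod)
    · exact (Complex.continuous_ofReal.tendsto _).comp
        (hlim0.comp ((tendsto_add_atTop_nat N).comp hι.tendsto_atTop))
    · have hcont : Continuous fun r : ℝ => Complex.exp (r * z) := by fun_prop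
      exact (hcont.tendsto _).comp hSι
  · rw [tprod_one_add_mul_eq hganti hg0 hgsum.hasSum z, pow_zero, mul_one, mul_assoc, ← mul_assoc
      (Complex.exp _) (Complex.exp _), ← Complex.exp_add]
    congr 3
    push_cast
    ring

theorem LaguerreLimit.mem_laguerrePosA {a : ℝ} (ha : 0 ≤ a) {f : ℂ → ℂ}
    (hf : LaguerreLimit a f) : f ∈ laguerrePosA a :=
  ⟨⟨hf.mem_laguerre ha, hf.2⟩, hf.mem_spaceA ha⟩

/-! ### The initial function and the renormalisation -/

lemma coeff_mul_nonneg {P Q : Polynomial ℝ} (hP : ∀ k, 0 ≤ P.coeff k) (hQ : ∀ k, 0 ≤ Q.coeff k)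
    (k : ℕ) : 0 ≤ (P * Q).coeff k := by
  rw [Polynomial.coeff_mul]
  exact Finset.sum_nonneg fun _ _ => mul_nonneg (hP _) (hQ _)

lemma coeff_C_nonneg {r : ℝ} (hr : 0 ≤ r) (k : ℕ) : 0 ≤ (Polynomial.C r).coeff k := by
  rw [Polynomial.coeff_C]; split_ifs <;> simp [hr]

lemma coeff_one_add_nonneg {r : ℝ} (hr : 0 ≤ r) (k : ℕ) :
    0 ≤ (1 + Polynomial.C r * Polynomial.X : Polynomial ℝ).coeff k := by
  rw [Polynomial.coeff_add, Polynomial.coeff_one, Polynomial.coeff_C_mul, Polynomial.coeff_X]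
  split_ifs <;> simp <;> positivity

lemma coeff_one_nonneg (k : ℕ) : 0 ≤ (1 : Polynomial ℝ).coeff k := by
  simpa using coeff_C_nonneg zero_le_one k

lemma coeff_prod_nonneg {P : ℕ → Polynomial ℝ} (hP : ∀ j k, 0 ≤ (P j).coeff k)
    (t : Finset ℕ) (k : ℕ) : 0 ≤ (∏ j ∈ t, P j).coeff k :=
  Finset.prod_induction P (fun Q => ∀ k, 0 ≤ Q.coeff k) (fun _ _ => coeff_mul_nonneg)
    coeff_one_nonneg (fun j _ => hP j) k

lemma coeff_pow_nonneg {P : Polynomial ℝ} (hP : ∀ k, 0 ≤ P.coeff k) (n k : ℕ) :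
    0 ≤ (P ^ n).coeff k := by
  simpa using coeff_prod_nonneg (fun _ => hP) (Finset.range n) k

lemma eval_nonneg {P : Polynomial ℝ} (hP : ∀ k, 0 ≤ P.coeff k) {x : ℝ} (hx : 0 ≤ x) :
    0 ≤ P.eval x := by
  rw [Polynomial.eval_eq_sum_range]
  exact Finset.sum_nonneg fun k _ => mul_nonneg (hP k) (by positivity)

lemma one_add_mul_ne_zero {r : ℝ} (hr : 0 ≤ r) {z : ℂ} (hz : z ∈ Complex.slitPlane) :
    1 + (r : ℂ) * z ≠ 0 := by
  intro h
  have hre := congrArg Complex.re h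
  have him := congrArg Complex.im h
  simp at hre him
  rw [Complex.mem_slitPlane_iff] at hz
  rcases him with h0 | h0
  · rw [h0] at hre; simp at hre
  · rcases hz with h1 | h1
    · nlinarith [mul_nonneg hr h1.le]
    · exact h1 h0

/-- The product `∏ (1 + γ_j x)` has exponential type zero. -/
lemma exists_prod_le_exp {γ : ℕ → ℝ} (h0 : ∀ j, 0 ≤ γ j) (hs : Summable γ) {ε : ℝ} (hε : 0 < ε) :
    ∃ K : ℝ, 0 ≤ K ∧ ∀ (n : ℕ) (x : ℝ), 0 ≤ x →
      ∏ j ∈ Finset.range n, (1 + γ j * x) ≤ K * Real.exp (ε * x) := by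
  have hε2 : 0 < ε / 2 := by positivity
  have htail := (tendsto_sum_nat_add γ).eventually_lt_const hε2
  obtain ⟨N, hN⟩ := htail.exists
  -- finitely many factors are absorbed by `e^{ηx}`; the others are at most `e^{γ_j x}`
  have hfin : ∀ m : ℕ, ∀ η : ℝ, 0 < η → ∃ K : ℝ, 0 ≤ K ∧ ∀ x : ℝ, 0 ≤ x →
      ∏ j ∈ Finset.range m, (1 + γ j * x) ≤ K * Real.exp (η * x) := by
    intro m
    induction m with
    | zero =>
      intro η hη
      exact ⟨1, zero_le_one, fun x hx => by simpa using by positivity⟩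
    | succ m ih =>
      intro η hη
      obtain ⟨K, hK0, hK⟩ := ih (η / 2) (by positivity)
      refine ⟨K * (1 + γ m / (η / 2)), ?_, fun x hx => ?_⟩
      · have := h0 m
        positivity
      have h1 : 1 + γ m * x ≤ (1 + γ m / (η / 2)) * Real.exp (η / 2 * x) := by
        have h2 := Real.add_one_le_exp (η / 2 * x)
        have h3 : 0 ≤ γ m / (η / 2) := div_nonneg (h0 m) (by positivity)
        have h4 : γ m * x = γ m / (η / 2) * (η / 2 * x) := by field_simp
        have h5 : 0 ≤ η / 2 * x := by positivity
        rw [h4]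
        nlinarith
      rw [Finset.prod_range_succ]
      have hm := h0 m
      calc _ ≤ (K * Real.exp (η / 2 * x)) * ((1 + γ m / (η / 2)) * Real.exp (η / 2 * x)) :=
            mul_le_mul (hK x hx) h1 (by positivity) (by positivity)
        _ = K * (1 + γ m / (η / 2)) * (Real.exp (η / 2 * x) * Real.exp (η / 2 * x)) := by ring
        _ = _ := by rw [← Real.exp_add]; ring_nf
  obtain ⟨K, hK0, hK⟩ := hfin N (ε / 2) hε2
  refine ⟨K, hK0, fun n x hx => ?_⟩
  have hone : ∀ j, 1 ≤ 1 + γ j * x := fun j => by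
    have := mul_nonneg (h0 j) hx
    linarith
  have hle : ∏ j ∈ Finset.range n, (1 + γ j * x) ≤ ∏ j ∈ Finset.range (N + n), (1 + γ j * x) := by
    rw [add_comm N, Finset.prod_range_add]
    refine le_mul_of_one_le_right (Finset.prod_nonneg fun j _ => by linarith [hone j]) ?_
    calc (1 : ℝ) = ∏ j ∈ Finset.range N, 1 := by simp
      _ ≤ _ := Finset.prod_le_prod (fun _ _ => zero_le_one) fun j _ => hone (n + j)
  refine hle.trans ?_
  rw [Finset.prod_range_add]
  have h2 : ∏ j ∈ Finset.range n, (1 + γ (N + j) * x) ≤ Real.exp (ε / 2 * x) := by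
    calc _ ≤ ∏ j ∈ Finset.range n, Real.exp (γ (N + j) * x) :=
          Finset.prod_le_prod (fun j _ => by linarith [hone (N + j)])
            (fun j _ => by linarith [Real.add_one_le_exp (γ (N + j) * x)])
      _ = Real.exp ((∑ j ∈ Finset.range n, γ (N + j)) * x) := by
          rw [← Real.exp_sum, Finset.sum_mul]
      _ ≤ _ := by
          refine Real.exp_le_exp.2 (mul_le_mul_of_nonneg_right (le_trans ?_ hN.le) hx)
          simp only [add_comm N]
          exact ((summable_nat_add_iff N).2 hs).sum_le_tsum _ (fun j _ => h0 _)
  calc _ ≤ (K * Real.exp (ε / 2 * x)) * Real.exp (ε / 2 * x) :=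
        mul_le_mul (hK x hx) h2 (Finset.prod_nonneg fun j _ => by linarith [hone (N + j)])
          (by positivity)
    _ = _ := by rw [mul_assoc, ← Real.exp_add]; ring_nf

/-- A Laguerre entire function with `g(0) > 0` is the limit of the polynomials
`g(0) (1 + α X / n)^n ∏_{j < n} (1 + γ_j X)`. -/
theorem IsLaguerreRep.laguerreLimit {g : ℂ → ℂ} {C : ℂ} {m : ℕ} {α : ℝ} {γ : ℕ → ℝ}
    (h : IsLaguerreRep g C m α γ) (h0 : ∃ r : ℝ, 0 < r ∧ g 0 = r) : LaguerreLimit α g := by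
  refine ⟨?_, h0⟩
  obtain ⟨r, hr, hgr⟩ := h0
  have hα := h.alpha_nonneg
  have hγ := h.gamma_nonneg
  have hval := h.eq 0
  have hm : m = 0 := by
    by_contra hm
    rw [zero_pow hm, hgr] at hval
    simp at hval
    exact hr.ne' hval
  subst hm
  have hC : C = r := by rw [hgr] at hval; simpa using hval.symm
  refine ⟨fun n => Polynomial.C r * (1 + Polynomial.C (α / n) * Polynomial.X) ^ n *
    ∏ j ∈ Finset.range n, (1 + Polynomial.C (γ j) * Polynomial.X), fun n => ?_, fun n z hz => ?_,
    fun b hb => ?_, fun z => ?_⟩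
  · exact coeff_mul_nonneg (coeff_mul_nonneg (coeff_C_nonneg hr.le)
      (coeff_pow_nonneg (coeff_one_add_nonneg (by positivity)) n))
      (coeff_prod_nonneg (fun j => coeff_one_add_nonneg (hγ j)) _)
  · simp only [Polynomial.map_mul, Polynomial.map_pow, Polynomial.map_add, Polynomial.map_prod,
      Polynomial.map_C, Polynomial.map_one, Polynomial.map_X, Polynomial.eval_mul,
      Polynomial.eval_pow, Polynomial.eval_add, Polynomial.eval_prod, Polynomial.eval_C,
      Polynomial.eval_X, Polynomial.eval_one, Complex.coe_algebraMap]
    refine mul_ne_zero (mul_ne_zero (by exact_mod_cast hr.ne') (pow_ne_zero _ ?_)) ?_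
    · exact one_add_mul_ne_zero (by positivity) hz
    · exact Finset.prod_ne_zero_iff.2 fun j _ => one_add_mul_ne_zero (hγ j) hz
  · obtain ⟨K, hK0, hK⟩ := exists_prod_le_exp hγ h.gamma_summable (sub_pos.2 hb)
    refine ⟨r * K, fun n x hx => ?_⟩
    simp only [Polynomial.eval_mul, Polynomial.eval_pow, Polynomial.eval_add, Polynomial.eval_prod,
      Polynomial.eval_C, Polynomial.eval_X, Polynomial.eval_one]
    have h1 : (1 + α / n * x) ^ n ≤ Real.exp (α * x) := by
      rcases Nat.eq_zero_or_pos n with rfl | hn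
      · simpa using by positivity
      · calc (1 + α / n * x) ^ n ≤ Real.exp (α / n * x) ^ n := by
              gcongr
              linarith [Real.add_one_le_exp (α / n * x)]
          _ = _ := by
              rw [← Real.exp_nat_mul]
              congr 1
              field_simp
    calc _ ≤ r * Real.exp (α * x) * (K * Real.exp ((b - α) * x)) := by
          refine mul_le_mul (mul_le_mul_of_nonneg_left h1 hr.le) (hK n x hx) ?_ (by positivity)
          exact Finset.prod_nonneg fun j _ => by have := hγ j; positivity
      _ = r * K * (Real.exp (α * x) * Real.exp ((b - α) * x)) := by ring
      _ = _ := by rw [← Real.exp_add]; ring_nf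
  · rw [h.eq z, hC, pow_zero, mul_one]
    simp only [map_mul, map_pow, map_add, map_prod, Polynomial.aeval_C, Polynomial.aeval_X, map_one,
      Complex.coe_algebraMap]
    refine Tendsto.mul (Tendsto.const_mul _ ?_) ?_
    · refine (Complex.tendsto_one_add_div_pow_exp (α * z)).congr fun n => ?_
      push_cast
      ring
    · refine Multipliable.tendsto_prod_tprod_nat ?_
      refine multipliable_one_add_of_summable ?_
      simp only [norm_mul, Complex.norm_real]
      exact (h.gamma_summable.norm).mul_right _

/-- The renormalisation multiplies the exponential type by `δ · δ^{-1-λ} = δ^{-λ}`. -/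
theorem LaguerreLimit.renorm {δ : ℕ} (hδ : 2 ≤ δ) (lam : ℝ) {a : ℝ} {f : ℂ → ℂ}
    (hf : LaguerreLimit a f) : LaguerreLimit (a * (δ : ℝ) ^ (-lam)) (renorm δ lam f) := by
  obtain ⟨⟨P, hP, hroot, hgr, hlim⟩, r, hr, hfr⟩ := hf
  have hδ0 : (0 : ℝ) < δ := by positivity
  set κ : ℝ := (δ : ℝ) ^ (-1 - lam) with hκdef
  have hκ : 0 < κ := Real.rpow_pos_of_pos hδ0 _
  have hκδ : (δ : ℝ) ^ (-lam) = δ * κ := by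
    rw [hκdef, show -lam = 1 + (-1 - lam) by ring, Real.rpow_add hδ0, Real.rpow_one]
  refine ⟨⟨fun n => ((P n).comp (Polynomial.C κ * Polynomial.X)) ^ δ, fun n => ?_, fun n z hz => ?_,
    fun b hb => ?_, fun z => ?_⟩, r ^ δ, by positivity, ?_⟩
  · refine coeff_pow_nonneg (fun k => ?_) δ
    rw [Polynomial.comp_C_mul_X_coeff]
    exact mul_nonneg (hP n k) (by positivity)
  · have hz' : (κ : ℂ) * z ∈ Complex.slitPlane := by
      rw [Complex.mem_slitPlane_iff] at hz ⊢
      simp only [Complex.re_ofReal_mul, Complex.im_ofReal_mul]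
      rcases hz with hz | hz
      · exact Or.inl (mul_pos hκ hz)
      · exact Or.inr (mul_ne_zero hκ.ne' hz)
    simp only [Polynomial.map_pow, Polynomial.map_comp, Polynomial.map_mul, Polynomial.map_C,
      Polynomial.map_X, Polynomial.eval_pow, Polynomial.eval_comp, Polynomial.eval_mul,
      Polynomial.eval_C, Polynomial.eval_X, Complex.coe_algebraMap]
    exact pow_ne_zero _ (hroot n _ hz')
  · have hδκ : 0 < δ * κ := by positivity
    obtain ⟨K, hK⟩ := hgr (b / (δ * κ)) (by rw [lt_div_iff₀ hδκ, ← hκδ]; exact hb)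
    refine ⟨K ^ δ, fun n x hx => ?_⟩
    have hx' : 0 ≤ κ * x := by positivity
    rw [Polynomial.eval_pow, Polynomial.eval_comp, Polynomial.eval_mul, Polynomial.eval_C,
      Polynomial.eval_X]
    calc _ ≤ (K * Real.exp (b / (δ * κ) * (κ * x))) ^ δ :=
          pow_le_pow_left₀ (eval_nonneg (hP n) hx') (hK n _ hx') δ
      _ = _ := by
          rw [mul_pow, ← Real.exp_nat_mul]
          congr 2
          field_simp
  · have h1 := (hlim (z * κ)).pow δ
    refine h1.congr fun n => ?_
    rw [map_pow, Polynomial.aeval_comp, map_mul, Polynomial.aeval_C, Polynomial.aeval_X,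
      Complex.coe_algebraMap, mul_comm z]
  · simp [LaguerreEvolution.renorm, hfr]

/-! ### Solutions with locally uniform growth -/

lemma exists_coeff_bound_of_growth {b b' : ℝ} (hb : 0 ≤ b) (hbb : b < b') (K : ℝ) :
    ∃ K' : ℝ, ∀ f : ℂ → ℂ, Differentiable ℂ f → (∀ z, ‖f z‖ ≤ K * Real.exp (b * ‖z‖)) →
      ∀ k, ‖iteratedDeriv k f 0‖ ≤ K' * b' ^ k := by
  obtain ⟨K', hK'⟩ := factorial_mul_le_of_growth hb hbb K
  refine ⟨K', fun f hf hgr k => ?_⟩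
  have hfac : (0 : ℝ) < k ! := by positivity
  have h := hK' k (‖iteratedDeriv k f 0‖ / (k ! : ℝ)) fun x hx => ?_
  · rwa [mul_div_cancel₀ _ hfac.ne'] at h
  rcases eq_or_lt_of_le hx with rfl | hx
  · have h0 := hgr 0
    rcases Nat.eq_zero_or_pos k with rfl | hk
    · simpa using h0
    · rw [zero_pow hk.ne', mul_zero]
      simpa using (norm_nonneg _).trans h0
  · have h1 := Complex.norm_iteratedDeriv_le_of_forall_mem_sphere_norm_le k hx hf.diffContOnCl
      (c := 0) (C := K * Real.exp (b * x)) fun z hz => by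
        have : ‖z‖ = x := by simpa using hz
        simpa [this] using hgr z
    rw [le_div_iff₀ (by positivity)] at h1
    rw [div_mul_eq_mul_div, div_le_iff₀ hfac]
    linarith

/-- Differentiability passes to uniform limits, when the derivatives converge uniformly; the version
for one-sided derivatives at the end points of an interval. -/
lemma hasDerivWithinAt_of_uniform_approx {I : Set ℝ} (hI : Convex ℝ I) {u v : ℝ → ℂ}
    (h : ∀ ε : ℝ, 0 < ε → ∃ u' v' : ℝ → ℂ, (∀ s ∈ I, HasDerivWithinAt u' (v' s) I s) ∧
      ∀ s ∈ I, ‖u' s - u s‖ ≤ ε ∧ ‖v' s - v s‖ ≤ ε) {t : ℝ} (ht : t ∈ I) :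
    HasDerivWithinAt u (v t) I t := by
  rw [hasDerivWithinAt_iff_isLittleO, Asymptotics.isLittleO_iff]
  intro C hC
  obtain ⟨u₁, v₁, hd, hbd⟩ := h (C / 3) (by positivity)
  have hlip : ∀ s ∈ I, ‖(u₁ s - u s) - (u₁ t - u t)‖ ≤ C / 3 * ‖s - t‖ := by
    intro s hs
    refine le_of_forall_pos_le_add fun η hη => ?_
    have hD : 0 ≤ ‖s - t‖ := norm_nonneg _
    obtain ⟨u₂, v₂, hd₂, hbd₂⟩ := h (η / (‖s - t‖ + 2)) (by positivity)
    set ζ := η / (‖s - t‖ + 2) with hζ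
    have hζη : ζ * (‖s - t‖ + 2) = η := by rw [hζ]; field_simp
    have hmv := hI.norm_image_sub_le_of_norm_hasDerivWithin_le
      (f := fun r => u₁ r - u₂ r) (f' := fun r => v₁ r - v₂ r) (C := C / 3 + ζ)
      (fun r hr => (hd r hr).sub (hd₂ r hr)) (fun r hr => by
        have e : v₁ r - v₂ r = (v₁ r - v r) - (v₂ r - v r) := by ring
        rw [e]
        exact (norm_sub_le _ _).trans (add_le_add (hbd r hr).2 (hbd₂ r hr).2)) ht hs
    have e : (u₁ s - u s) - (u₁ t - u t) =
        ((u₁ s - u₂ s) - (u₁ t - u₂ t)) + ((u₂ s - u s) - (u₂ t - u t)) := by ring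
    rw [e]
    calc _ ≤ (C / 3 + ζ) * ‖s - t‖ + (ζ + ζ) :=
          (norm_add_le _ _).trans (add_le_add hmv ((norm_sub_le _ _).trans
            (add_le_add (hbd₂ s hs).1 (hbd₂ t ht).1)))
      _ = _ := by rw [← hζη]; ring
  have hlo := (hasDerivWithinAt_iff_isLittleO.1 (hd t ht))
  rw [Asymptotics.isLittleO_iff] at hlo
  filter_upwards [hlo (c := C / 3) (by positivity), self_mem_nhdsWithin] with s h1 hs
  have e : u s - u t - (s - t) • v t = -((u₁ s - u s) - (u₁ t - u t)) +
      (u₁ s - u₁ t - (s - t) • v₁ t) + (s - t) • (v₁ t - v t) := by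
    simp only [Complex.real_smul]; ring
  rw [e]
  calc _ ≤ C / 3 * ‖s - t‖ + C / 3 * ‖s - t‖ + ‖s - t‖ * (C / 3) := by
        refine (norm_add₃_le).trans (add_le_add (add_le_add ?_ h1) ?_)
        · rw [norm_neg]; exact hlip s hs
        · rw [norm_smul]; exact mul_le_mul_of_nonneg_left (hbd t ht).2 (norm_nonneg _)
    _ = _ := by ring

lemma norm_egf_sub_sum_le {c : ℕ → ℂ} {K b : ℝ} (hb : 0 ≤ b) (hc : ∀ k, ‖c k‖ ≤ K * b ^ k)
    (z : ℂ) (N : ℕ) : ‖egf c z - ∑ i ∈ Finset.range N, c i * (z ^ i / (i ! : ℂ))‖ ≤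
      K * (b * ‖z‖) ^ N * Real.exp (b * ‖z‖) := by
  have hK : 0 ≤ K := by simpa using (norm_nonneg _).trans (hc 0)
  have hs := summable_egf hc z
  have e : egf c z - ∑ i ∈ Finset.range N, c i * (z ^ i / (i ! : ℂ)) =
      ∑' i, c (i + N) * (z ^ (i + N) / ((i + N)! : ℂ)) := by
    rw [sub_eq_iff_eq_add', egf, hs.sum_add_tsum_nat_add N]
  rw [e]
  have h : HasSum (fun k : ℕ => K * (b * ‖z‖) ^ N * ((b * ‖z‖) ^ k / (k ! : ℝ)))
      (K * (b * ‖z‖) ^ N * Real.exp (b * ‖z‖)) := by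
    have := (NormedSpace.expSeries_div_hasSum_exp (b * ‖z‖)).mul_left (K * (b * ‖z‖) ^ N)
    rwa [← Real.exp_eq_exp_ℝ] at this
  refine tsum_of_norm_bounded h fun i => (norm_egf_term_le hc z _).trans ?_
  have hle : ((i ! : ℕ) : ℝ) ≤ ((i + N)! : ℕ) := by
    exact_mod_cast Nat.factorial_le (Nat.le_add_right i N)
  calc _ = K * (b * ‖z‖) ^ N * ((b * ‖z‖) ^ i / ((i + N)! : ℝ)) := by
        rw [mul_pow, mul_pow, pow_add, pow_add]; ring
    _ ≤ _ := by gcongr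

/-- If a family of entire functions with uniform growth is differentiable in `t` at every point `z`,
then so are its Taylor coefficients: after subtraction of the lower terms of the expansion and
division by `z^k`, the coefficient of order `k` is a uniform limit for `z → 0`. -/
lemma hasDerivWithinAt_coeff {I : Set ℝ} (hI : Convex ℝ I) {c c' : ℝ → ℕ → ℂ} {K b K' b' : ℝ}
    (hb : 0 ≤ b) (hb' : 0 ≤ b') (hc : ∀ t ∈ I, ∀ k, ‖c t k‖ ≤ K * b ^ k)
    (hc' : ∀ t ∈ I, ∀ k, ‖c' t k‖ ≤ K' * b' ^ k)
    (hd : ∀ z, ∀ t ∈ I, HasDerivWithinAt (fun s => egf (c s) z) (egf (c' t) z) I t) (k : ℕ) :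
    ∀ t ∈ I, HasDerivWithinAt (fun s => c s k) (c' t k) I t := by
  induction k using Nat.strong_induction_on with
  | _ k ih =>
  intro t ht
  have hK : 0 ≤ K := by simpa using (norm_nonneg _).trans (hc t ht 0)
  have hK' : 0 ≤ K' := by simpa using (norm_nonneg _).trans (hc' t ht 0)
  refine hasDerivWithinAt_of_uniform_approx (u := fun s => c s k) (v := fun s => c' s k) hI
    (fun ε hε => ?_) ht
  -- the error of the approximation at a point `x ∈ (0, 1]` is at most `A x`
  let A : ℝ := (k ! : ℝ) * (K * b ^ (k + 1) * Real.exp b + K' * b' ^ (k + 1) * Real.exp b')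
  have hA : 0 ≤ A := by positivity
  let x : ℝ := min 1 (ε / (A + 1))
  have hx0 : 0 < x := lt_min one_pos (by positivity)
  have hx1 : x ≤ 1 := min_le_left _ _
  have hxA : A * x ≤ ε := by
    calc A * x ≤ A * (ε / (A + 1)) := mul_le_mul_of_nonneg_left (min_le_right _ _) hA
      _ = ε * (A / (A + 1)) := by ring
      _ ≤ ε * 1 := by
          refine mul_le_mul_of_nonneg_left ?_ hε.le
          rw [div_le_one (by positivity)]; linarith
      _ = ε := mul_one _
  have hxC : (x : ℂ) ≠ 0 := by exact_mod_cast hx0.ne'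
  have hkC : (k ! : ℂ) ≠ 0 := by exact_mod_cast k.factorial_ne_zero
  let T : (ℕ → ℂ) → ℂ := fun d => ((k ! : ℂ) / (x : ℂ) ^ k) *
    (egf d x - ∑ i ∈ Finset.range k, d i * ((x : ℂ) ^ i / (i ! : ℂ)))
  have herr : ∀ (d : ℕ → ℂ) (M β : ℝ), 0 ≤ M → 0 ≤ β → (∀ i, ‖d i‖ ≤ M * β ^ i) →
      ‖T d - d k‖ ≤ (k ! : ℝ) * (M * β ^ (k + 1) * Real.exp β) * x := by
    intro d M β hM hβ hd
    have h := norm_egf_sub_sum_le hβ hd (x : ℂ) (k + 1)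
    rw [Complex.norm_real, Real.norm_of_nonneg hx0.le] at h
    have e : T d - d k = ((k ! : ℂ) / (x : ℂ) ^ k) *
        (egf d x - ∑ i ∈ Finset.range (k + 1), d i * ((x : ℂ) ^ i / (i ! : ℂ))) := by
      simp only [T]
      rw [Finset.sum_range_succ]
      field_simp
      ring
    rw [e, norm_mul, norm_div, norm_pow, Complex.norm_natCast, Complex.norm_real,
      Real.norm_of_nonneg hx0.le]
    calc _ ≤ (k ! : ℝ) / x ^ k * (M * (β * x) ^ (k + 1) * Real.exp (β * x)) :=
          mul_le_mul_of_nonneg_left h (by positivity)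
      _ = (k ! : ℝ) * (M * β ^ (k + 1) * Real.exp (β * x)) * x := by
          rw [mul_pow, pow_succ x]; field_simp
      _ ≤ _ := by
          gcongr
          exact mul_le_of_le_one_right hβ hx1
  refine ⟨fun s => T (c s), fun s => T (c' s), fun s hs => ?_, fun s hs => ⟨?_, ?_⟩⟩
  · refine HasDerivWithinAt.const_mul _ ((hd x s hs).sub ?_)
    exact HasDerivWithinAt.fun_sum fun i hi => (ih i (Finset.mem_range.1 hi) s hs).mul_const _
  · refine (herr (c s) K b hK hb (hc s hs)).trans (le_trans ?_ hxA)
    refine mul_le_mul_of_nonneg_right (mul_le_mul_of_nonneg_left ?_ (by positivity)) hx0.le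
    exact le_add_of_nonneg_right (by positivity)
  · refine (herr (c' s) K' b' hK' hb' (hc' s hs)).trans (le_trans ?_ hxA)
    refine mul_le_mul_of_nonneg_right (mul_le_mul_of_nonneg_left ?_ (by positivity)) hx0.le
    exact le_add_of_nonneg_left (by positivity)

lemma rising_succ' (x : ℝ) (n : ℕ) : rising x (n + 1) = rising x n * (x + n) :=
  Finset.prod_range_succ _ _

/-- The Taylor polynomial, expanded at a variable point `s`, of a solution of the coefficient system
has the telescoping derivative of Taylor's formula. -/
lemma hasDerivWithinAt_taylor {I : Set ℝ} {θ τ : ℝ} {c : ℝ → ℕ → ℂ}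
    (hd : ∀ k, ∀ t ∈ I, HasDerivWithinAt (fun s => c s k)
      ((τ : ℂ) * (((θ : ℂ) + k) * c t (k + 1))) I t) (t : ℝ) (j N : ℕ) {s : ℝ} (hs : s ∈ I) :
    HasDerivWithinAt (fun s : ℝ => ∑ n ∈ Finset.range (N + 1),
        (((t - s) ^ n * (τ ^ n * rising (θ + j) n / (n ! : ℝ)) : ℝ) : ℂ) * c s (j + n))
      ((((t - s) ^ N * (τ ^ (N + 1) * rising (θ + j) (N + 1) / (N ! : ℝ)) : ℝ) : ℂ) *
        c s (j + (N + 1))) I s := by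
  induction N with
  | zero =>
    convert hd j s hs using 1
    · funext r; simp [rising_zero]
    · simp [rising_succ', rising_zero]; ring
  | succ N ih =>
    simp only [Finset.sum_range_succ _ (N + 1)]
    have h1 : HasDerivWithinAt (fun r : ℝ => (t - r) ^ (N + 1))
        (((N + 1 : ℕ) : ℝ) * (t - s) ^ N * (-1)) I s := by
      have := ((hasDerivAt_id s).const_sub t).fun_pow (N + 1)
      simpa using this.hasDerivWithinAt
    have h2 := ((h1.mul_const (τ ^ (N + 1) * rising (θ + j) (N + 1) /
      ((N + 1)! : ℝ))).ofReal_comp).mul (hd (j + (N + 1)) s hs)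
    refine (ih.add h2).congr_deriv ?_
    have hN1 : (N ! : ℂ) ≠ 0 := by exact_mod_cast N.factorial_ne_zero
    have hN2 : (N + 1 : ℂ) ≠ 0 := by exact_mod_cast N.succ_ne_zero
    rw [rising_succ' (θ + j) (N + 1), Nat.factorial_succ]
    push_cast
    rw [show j + (N + 1) + 1 = j + (N + 1 + 1) by ring]
    field_simp
    ring

/-- A solution of the coefficient system with uniform geometric growth vanishes on a short interval
if it vanishes at one of its points. -/
lemma coeff_eq_zero_of_short {I : Set ℝ} (hI : Convex ℝ I) {θ τ K b l : ℝ} (hθ : 0 ≤ θ)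
    (hτ : 0 ≤ τ) (hb : 0 ≤ b) (hl : 0 ≤ l) (hlb : l * τ * b < 1) {c : ℝ → ℕ → ℂ}
    (hlen : ∀ s ∈ I, ∀ t ∈ I, |t - s| ≤ l) (hc : ∀ t ∈ I, ∀ k, ‖c t k‖ ≤ K * b ^ k)
    (hd : ∀ k, ∀ t ∈ I, HasDerivWithinAt (fun s => c s k)
      ((τ : ℂ) * (((θ : ℂ) + k) * c t (k + 1))) I t) {t₀ t : ℝ} (ht₀ : t₀ ∈ I) (ht : t ∈ I)
    (h0 : ∀ k, c t₀ k = 0) (j : ℕ) : c t j = 0 := by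
  have hK : 0 ≤ K := by simpa using (norm_nonneg _).trans (hc t ht 0)
  have hbound : ∀ N : ℕ, ‖c t j‖ ≤ K * b ^ j * ((θ + j) * (l * τ * b)) *
      (((N + (⌈θ⌉₊ + (j + 1))).choose (⌈θ⌉₊ + (j + 1)) : ℝ) * (l * τ * b) ^ N) := by
    intro N
    have hmv := hI.norm_image_sub_le_of_norm_hasDerivWithin_le
      (fun s hs => hasDerivWithinAt_taylor hd t j N hs) (fun s hs => ?_)
      ht₀ ht (C := l ^ N * (τ ^ (N + 1) * rising (θ + j) (N + 1) / (N ! : ℝ)) *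
        (K * b ^ (j + (N + 1))))
    · have e1 : ∑ n ∈ Finset.range (N + 1),
          (((t - t) ^ n * (τ ^ n * rising (θ + j) n / (n ! : ℝ)) : ℝ) : ℂ) * c t (j + n) =
            c t j := by
        rw [Finset.sum_range_succ', Finset.sum_eq_zero fun n _ => by simp]
        simp [rising_zero]
      have e2 : ∑ n ∈ Finset.range (N + 1), (((t - t₀) ^ n * (τ ^ n * rising (θ + j) n /
          (n ! : ℝ)) : ℝ) : ℂ) * c t₀ (j + n) = 0 :=
        Finset.sum_eq_zero fun n _ => by rw [h0, mul_zero]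
      simp only [e1, e2, sub_zero] at hmv
      have hr : 0 ≤ rising (θ + j) (N + 1) := rising_nonneg (by positivity) _
      have hrr : rising (θ + j) (N + 1) / (N ! : ℝ) ≤ (θ + j) *
          ((N + (⌈θ⌉₊ + (j + 1))).choose (⌈θ⌉₊ + (j + 1)) : ℝ) := by
        rw [rising_succ, mul_div_assoc]
        refine mul_le_mul_of_nonneg_left ?_ (by positivity)
        have := rising_div_factorial_le hθ (j + 1) N
        push_cast at this
        rwa [← add_assoc] at this
      calc ‖c t j‖ ≤ l ^ N * (τ ^ (N + 1) * rising (θ + j) (N + 1) / (N ! : ℝ)) *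
              (K * b ^ (j + (N + 1))) * l :=
            hmv.trans (mul_le_mul_of_nonneg_left (hlen _ ht₀ _ ht) (by positivity))
        _ = (l ^ (N + 1) * τ ^ (N + 1) * (K * b ^ (j + (N + 1)))) *
              (rising (θ + j) (N + 1) / (N ! : ℝ)) := by ring
        _ ≤ (l ^ (N + 1) * τ ^ (N + 1) * (K * b ^ (j + (N + 1)))) * ((θ + j) *
              ((N + (⌈θ⌉₊ + (j + 1))).choose (⌈θ⌉₊ + (j + 1)) : ℝ)) :=
            mul_le_mul_of_nonneg_left hrr (by positivity)
        _ = _ := by rw [mul_pow (l * τ), mul_pow l]; ring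
    · have hr : 0 ≤ rising (θ + j) (N + 1) := rising_nonneg (by positivity) _
      rw [norm_mul, Complex.norm_real, norm_mul, norm_pow, Real.norm_eq_abs,
        Real.norm_of_nonneg (by positivity : 0 ≤ τ ^ (N + 1) * rising (θ + j) (N + 1) / (N ! : ℝ))]
      have h1 := hlen s hs t ht
      have h2 := hc s hs (j + (N + 1))
      gcongr
  have hx : ‖l * τ * b‖ < 1 := by rwa [Real.norm_of_nonneg (by positivity)]
  have hlim := ((summable_choose_mul_geometric_of_norm_lt_one (⌈θ⌉₊ + (j + 1))
    hx).tendsto_atTop_zero).const_mul (K * b ^ j * ((θ + j) * (l * τ * b)))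
  rw [mul_zero] at hlim
  exact norm_le_zero_iff.1 (ge_of_tendsto hlim (Eventually.of_forall hbound))

/-! ### Uniqueness -/

/-- `w` is a family of entire functions on the time set `I` with `∂w/∂t = τ Δ_θ w` pointwise. -/
structure IsFlow (θ τ : ℝ) (I : Set ℝ) (w : ℝ → ℂ → ℂ) : Prop where
  differentiable : ∀ t ∈ I, Differentiable ℂ (w t)
  equation : ∀ t ∈ I, ∀ z : ℂ,
    HasDerivWithinAt (fun s : ℝ => w s z) ((τ : ℂ) * deltaOp θ (w t) z) I t

lemma IsFlow.mono {θ τ : ℝ} {I J : Set ℝ} {w : ℝ → ℂ → ℂ} (h : IsFlow θ τ I w) (hJ : J ⊆ I) :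
    IsFlow θ τ J w :=
  ⟨fun t ht => h.differentiable t (hJ ht), fun t ht z => (h.equation t (hJ ht) z).mono hJ⟩

lemma deltaOp_sub (θ : ℝ) {f g : ℂ → ℂ} (hf : Differentiable ℂ f) (hg : Differentiable ℂ g)
    (z : ℂ) : deltaOp θ (fun x => f x - g x) z = deltaOp θ f z - deltaOp θ g z := by
  have h1 : deriv (fun x => f x - g x) = fun x => deriv f x - deriv g x := by
    funext x; exact deriv_fun_sub (hf x) (hg x)
  have h2 : deriv (deriv (fun x => f x - g x)) z = deriv (deriv f) z - deriv (deriv g) z := by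
    rw [h1]
    exact deriv_fun_sub ((hf.analyticAt z).deriv.differentiableAt)
      ((hg.analyticAt z).deriv.differentiableAt)
  rw [deltaOp, h2, h1, deltaOp, deltaOp]
  ring

lemma IsFlow.sub {θ τ : ℝ} {I : Set ℝ} {w v : ℝ → ℂ → ℂ} (hw : IsFlow θ τ I w)
    (hv : IsFlow θ τ I v) : IsFlow θ τ I (fun t z => w t z - v t z) := by
  refine ⟨fun t ht => (hw.differentiable t ht).sub (hv.differentiable t ht), fun t ht z => ?_⟩
  have := (hw.equation t ht z).sub (hv.equation t ht z)
  rw [deltaOp_sub θ (hw.differentiable t ht) (hv.differentiable t ht), mul_sub]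
  exact this

/-- Uniqueness for short times and under a growth bound that is uniform in time. -/
lemma IsFlow.eq_zero_of_short {θ τ b l K : ℝ} (hθ : 0 ≤ θ) (hτ : 0 ≤ τ) (hb : 0 ≤ b) (hl : 0 ≤ l)
    (hlb : l * τ * (b + 1) < 1) {I : Set ℝ} (hI : Convex ℝ I) {w : ℝ → ℂ → ℂ}
    (hw : IsFlow θ τ I w) (hlen : ∀ s ∈ I, ∀ t ∈ I, |t - s| ≤ l)
    (hgr : ∀ t ∈ I, ∀ z, ‖w t z‖ ≤ K * Real.exp (b * ‖z‖)) {t₀ t : ℝ} (ht₀ : t₀ ∈ I) (ht : t ∈ I)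
    (h0 : ∀ z, w t₀ z = 0) (z : ℂ) : w t z = 0 := by
  obtain ⟨K', hK'⟩ := exists_coeff_bound_of_growth hb (lt_add_one b) K
  let c : ℝ → ℕ → ℂ := fun t k => iteratedDeriv k (w t) 0
  have hc : ∀ t ∈ I, ∀ k, ‖c t k‖ ≤ K' * (b + 1) ^ k := fun t ht =>
    hK' (w t) (hw.differentiable t ht) (hgr t ht)
  have hwc : ∀ t ∈ I, w t = egf (c t) := fun t ht =>
    eq_egf_of_differentiable (hw.differentiable t ht)
  have hsh := fun t ht => shift_weight_bound hθ (hc t ht)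
  have hd : ∀ k, ∀ t ∈ I, HasDerivWithinAt (fun s => c s k)
      ((τ : ℂ) * (((θ : ℂ) + k) * c t (k + 1))) I t := by
    refine fun k => hasDerivWithinAt_coeff
      (c' := fun t k => (τ : ℂ) * (((θ : ℂ) + k) * c t (k + 1)))
      (K := K') (b := b + 1) (K' := τ * ((θ + 1) * K' * (b + 1))) (b' := 2 * (b + 1))
      hI (by positivity) (by positivity) hc (fun t ht k => ?_) (fun z t ht => ?_) k
    · rw [norm_mul, Complex.norm_real, Real.norm_of_nonneg hτ, mul_assoc τ]
      exact mul_le_mul_of_nonneg_left (hsh t ht k) hτ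
    · have h1 := hw.equation t ht z
      rw [hwc t ht, deltaOp_egf θ (hc t ht)] at h1
      have h2 : egf (fun k => (τ : ℂ) * (((θ : ℂ) + k) * c t (k + 1))) z =
          τ * egf (fun k => ((θ : ℂ) + k) * c t (k + 1)) z := by
        simp only [egf, mul_assoc]
        rw [tsum_mul_left]
      simp only [h2]
      exact h1.congr (fun s hs => by rw [hwc s hs]) (by rw [hwc t ht])
  have hz0 : ∀ k, c t₀ k = 0 := by
    intro k
    have : w t₀ = fun _ => 0 := funext h0
    simp only [c, this]
    simp
  have hct := coeff_eq_zero_of_short hI hθ hτ (by positivity) hl hlb hlen hc hd ht₀ ht hz0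
  rw [hwc t ht]
  simp [egf, hct]

/-- Growth of exponential type `b`, locally uniformly in time. -/
def LocallyUniformGrowth (b : ℝ) (I : Set ℝ) (w : ℝ → ℂ → ℂ) : Prop :=
  ∀ t ∈ I, ∃ K : ℝ, ∀ᶠ s in 𝓝[I] t, ∀ z, ‖w s z‖ ≤ K * Real.exp (b * ‖z‖)

/-- Uniqueness under a growth bound that is locally uniform in time. -/
lemma IsFlow.eq_zero_of_locallyUniformGrowth {θ τ b : ℝ} (hθ : 0 ≤ θ) (hτ : 0 ≤ τ) (hb : 0 ≤ b)
    {I : Set ℝ} (hI : Convex ℝ I) {w : ℝ → ℂ → ℂ} (hw : IsFlow θ τ I w)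
    (hgr : LocallyUniformGrowth b I w) {t₀ t : ℝ} (ht₀ : t₀ ∈ I) (ht : t ∈ I)
    (h0 : ∀ z, w t₀ z = 0) (z : ℂ) : w t z = 0 := by
  have hl0 : 0 < 1 / (2 * (τ * (b + 1) + 1)) := by positivity
  set l := 1 / (2 * (τ * (b + 1) + 1)) with hl
  have hlb : l * τ * (b + 1) < 1 := by
    rw [hl, mul_assoc, one_div_mul_eq_div, div_lt_one (by positivity)]
    nlinarith [mul_nonneg hτ (by positivity : 0 ≤ b + 1)]
  -- vanishing is an open and closed condition on the time
  have key := hI.isPreconnected.induction₂ (fun x y => (∀ z, w x z = 0) ↔ ∀ z, w y z = 0)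
    (fun x hx => ?_) (fun x y z _ _ _ hxy hyz => hxy.trans hyz) (fun x y _ _ h => h.symm) ht₀ ht
  · exact key.1 h0 z
  · obtain ⟨K, hK⟩ := hgr x hx
    obtain ⟨ρ, hρ, hball⟩ := Metric.mem_nhdsWithin_iff.1 hK
    let J := I ∩ Metric.ball x (min ρ (l / 2))
    have hr : 0 < min ρ (l / 2) := lt_min hρ (by positivity)
    have hJ : Convex ℝ J := hI.inter (convex_ball _ _)
    have hxJ : x ∈ J := ⟨hx, Metric.mem_ball_self hr⟩
    have hlen : ∀ s ∈ J, ∀ t ∈ J, |t - s| ≤ l := by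
      intro s hs t ht
      have h1 := (Metric.mem_ball.1 hs.2).trans_le (min_le_right _ _)
      have h2 := (Metric.mem_ball.1 ht.2).trans_le (min_le_right _ _)
      rw [Real.dist_eq] at h1 h2
      have h3 := abs_sub_le t x s
      rw [abs_sub_comm x s] at h3
      linarith
    have hgrJ : ∀ s ∈ J, ∀ z, ‖w s z‖ ≤ K * Real.exp (b * ‖z‖) := fun s hs =>
      hball ⟨Metric.ball_subset_ball (min_le_left _ _) hs.2, hs.1⟩
    have hwJ : IsFlow θ τ J w := hw.mono inter_subset_left
    filter_upwards [inter_mem_nhdsWithin I (Metric.ball_mem_nhds x hr)] with y hy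
    exact ⟨fun h => hwJ.eq_zero_of_short hθ hτ hb hl0.le hlb hJ hlen hgrJ hxJ hy h,
      fun h => hwJ.eq_zero_of_short hθ hτ hb hl0.le hlb hJ hlen hgrJ hy hxJ h⟩

lemma IsFlow.continuousOn {θ τ : ℝ} {I : Set ℝ} {w : ℝ → ℂ → ℂ} (hw : IsFlow θ τ I w) (z : ℂ) :
    ContinuousOn (fun s => w s z) I := fun t ht => (hw.equation t ht z).continuousWithinAt

/-- The evolution of `f`, started at time `p`, is a flow as long as the type stays finite. -/
lemma isFlow_evol {θ τ K b p : ℝ} (hθ : 0 ≤ θ) (hτ : 0 ≤ τ) (hb : 0 < b) {f : ℂ → ℂ}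
    (hf : ∀ k, ‖iteratedDeriv k f 0‖ ≤ K * b ^ k) {I : Set ℝ}
    (hI : ∀ t ∈ I, b * (|t - p| * τ) < 1) :
    IsFlow θ τ I (fun t => evol θ ((t - p) * τ) f) := by
  have habs : ∀ t ∈ I, b * |(t - p) * τ| < 1 := fun t ht => by
    rw [abs_mul, abs_of_nonneg hτ]; exact hI t ht
  refine ⟨fun t ht z => ?_, fun t ht z => ?_⟩
  · exact (hasDerivAt_egf (norm_evolCoef_le hθ hb hf le_rfl (habs t ht)) z).differentiableAt
  · have h1 := hasDerivAt_egf_evolCoef hθ hb hf (habs t ht) z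
    have h2 : HasDerivAt (fun s : ℝ => (s - p) * τ) τ t := by
      simpa using ((hasDerivAt_id t).sub_const p).mul_const τ
    have h3 := h1.scomp t h2
    rw [Complex.real_smul] at h3
    exact h3.hasDerivWithinAt

/-- Up to half of its life span, the evolution at most doubles the type. -/
lemma norm_evol_le {θ K b s : ℝ} (hθ : 0 ≤ θ) (hb : 0 < b) {f : ℂ → ℂ}
    (hf : ∀ k, ‖iteratedDeriv k f 0‖ ≤ K * b ^ k) (hs : b * |s| ≤ 1 / 2) (z : ℂ) :
    ‖evol θ s f z‖ ≤ K * 2 ^ (⌈θ⌉₊ + 1) * Real.exp (2 * b * ‖z‖) := by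
  have hS : b * (1 / (2 * b)) = 1 / 2 := by field_simp
  have h := norm_evolCoef_le hθ hb hf (S := 1 / (2 * b)) (s := s)
    (by rw [le_div_iff₀ (by positivity)]; linarith) (by rw [hS]; norm_num)
  rw [hS] at h
  refine (norm_egf_le h z).trans_eq ?_
  rw [show (1 : ℝ) - 1 / 2 = 2⁻¹ by norm_num, inv_pow, div_inv_eq_mul, div_inv_eq_mul, mul_comm b]

lemma evol_zero {θ : ℝ} {f : ℂ → ℂ} (hf : Differentiable ℂ f) : evol θ 0 f = f := by
  rw [evol, evolCoef_zero]; exact (eq_egf_of_differentiable hf).symm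

/-- If a flow has locally uniform growth on a short interval `S` with one end point `p` missing,
then it is the evolution of its value at `p`. The growth near `p` need not be known: the flow is the
evolution of any of its values, first on `S`, then by continuity at `p`, and is thereby bounded up
to `p`. -/
lemma IsFlow.eq_evol_of_endpoint {θ τ b p : ℝ} (hθ : 0 ≤ θ) (hτ : 0 ≤ τ) (hb : 0 < b) {S : Set ℝ}
    (hS : Convex ℝ S) (hT : Convex ℝ (insert p S)) (hp : p ∈ closure S) {w : ℝ → ℂ → ℂ}
    (hw : IsFlow θ τ (insert p S) w)
    (hcoef : ∀ t ∈ insert p S, ∃ K : ℝ, ∀ k, ‖iteratedDeriv k (w t) 0‖ ≤ K * b ^ k)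
    (hlen : ∀ s ∈ insert p S, ∀ t ∈ insert p S, b * (|t - s| * τ) ≤ 1 / 2)
    (hgr : LocallyUniformGrowth (2 * b) S w) {t : ℝ} (ht : t ∈ S) :
    w t = evol θ ((t - p) * τ) (w p) := by
  have hpT : p ∈ insert p S := mem_insert p S
  have hST : S ⊆ insert p S := subset_insert p S
  have habs : ∀ s ∈ insert p S, ∀ r ∈ insert p S, b * |(r - s) * τ| ≤ 1 / 2 := fun s hs r hr => by
    rw [abs_mul, abs_of_nonneg hτ]; exact hlen s hs r hr
  have hflow : ∀ q ∈ insert p S, IsFlow θ τ (insert p S) (fun s => evol θ ((s - q) * τ) (w q)) := by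
    intro q hq
    obtain ⟨K, hK⟩ := hcoef q hq
    exact isFlow_evol hθ hτ hb hK fun s hs => (hlen q hq s hs).trans_lt (by norm_num)
  have hself : ∀ q ∈ insert p S, evol θ ((q - q) * τ) (w q) = w q := fun q hq => by
    rw [sub_self, zero_mul, evol_zero (hw.differentiable q hq)]
  obtain ⟨K₁, hK₁⟩ := hcoef t (hST ht)
  obtain ⟨K₂, hK₂⟩ := hcoef p hpT
  have hb₁ := fun s (hs : s ∈ insert p S) z =>
    norm_evol_le hθ hb hK₁ (habs t (hST ht) s hs) z
  have hb₂ := fun s (hs : s ∈ insert p S) z => norm_evol_le hθ hb hK₂ (habs p hpT s hs) z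
  have hnorm : ∀ {x y : ℂ} {A B E : ℝ}, ‖x‖ ≤ A * E → ‖y‖ ≤ B * E → ‖x - y‖ ≤ (A + B) * E := by
    intro x y A B E hx hy
    rw [add_mul]
    exact (norm_sub_le _ _).trans (add_le_add hx hy)
  -- on `S`, the flow is the evolution of its value at `t`
  have hon : ∀ s ∈ S, ∀ z, w s z = evol θ ((s - t) * τ) (w t) z := by
    intro s hs z
    refine sub_eq_zero.1 (((hw.sub (hflow t (hST ht))).mono hST).eq_zero_of_locallyUniformGrowth
      hθ hτ (b := 2 * b) (by positivity) hS (fun r hr => ?_) ht hs (fun y => ?_) z)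
    · obtain ⟨K, hK⟩ := hgr r hr
      refine ⟨K + K₁ * 2 ^ (⌈θ⌉₊ + 1), ?_⟩
      filter_upwards [hK, self_mem_nhdsWithin] with q hq hqS y
      exact hnorm (hq y) (hb₁ q (hST hqS) y)
    · exact sub_eq_zero.2 (congrFun (hself t (hST ht)).symm y)
  have honT : ∀ s ∈ insert p S, ∀ z, w s z = evol θ ((s - t) * τ) (w t) z := by
    intro s hs z
    rcases hs with rfl | hs
    · have : NeBot (𝓝[S] s) := mem_closure_iff_nhdsWithin_neBot.1 hp
      have h1 := ((hw.continuousOn z) s hpT).mono_left (nhdsWithin_mono s hST)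
      have h2 := (((hflow t (hST ht)).continuousOn z) s hpT).mono_left (nhdsWithin_mono s hST)
      refine tendsto_nhds_unique h1 (h2.congr' ?_)
      filter_upwards [self_mem_nhdsWithin] with q hq
      exact (hon q hq z).symm
    · exact hon s hs z
  funext z
  refine sub_eq_zero.1 ((hw.sub (hflow p hpT)).eq_zero_of_locallyUniformGrowth
    hθ hτ (b := 2 * b) (by positivity) hT (fun r hr => ?_) hpT (hST ht) (fun y => ?_) z)
  · refine ⟨K₁ * 2 ^ (⌈θ⌉₊ + 1) + K₂ * 2 ^ (⌈θ⌉₊ + 1), ?_⟩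
    filter_upwards [self_mem_nhdsWithin] with q hq y
    refine hnorm ?_ (hb₂ q hq y)
    rw [honT q hq y]
    exact hb₁ q hq y
  · exact sub_eq_zero.2 (congrFun (hself p hpT).symm y)

/-- A closed nonempty set of times contains a relatively open part on which the growth of a flow is
uniform, by Baire's theorem. -/
lemma IsFlow.exists_uniform_growth_on_portion {θ τ b : ℝ} {I F : Set ℝ} {w : ℝ → ℂ → ℂ}
    (hw : IsFlow θ τ I w) (hFI : F ⊆ I) (hF : IsClosed F) (hne : F.Nonempty)
    (hgr : ∀ t ∈ I, ∃ K : ℝ, ∀ z, ‖w t z‖ ≤ K * Real.exp (b * ‖z‖)) :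
    ∃ K : ℝ, ∃ t₀ ∈ F, ∃ ρ : ℝ, 0 < ρ ∧ ∀ s ∈ F, |s - t₀| < ρ →
      ∀ z, ‖w s z‖ ≤ K * Real.exp (b * ‖z‖) := by
  have : Nonempty F := hne.to_subtype
  have : CompleteSpace F := hF.completeSpace_coe
  let Q : ℕ → Set F := fun K => {t | ∀ z, ‖w t z‖ ≤ K * Real.exp (b * ‖z‖)}
  have hQ : ∀ K, IsClosed (Q K) := by
    intro K
    simp only [Q, ofPred_forall]
    refine isClosed_iInter fun z => isClosed_le ?_ continuous_const
    exact (continuousOn_iff_continuous_domRestrict.1 ((hw.continuousOn z).mono hFI)).norm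
  have hU : ⋃ K, Q K = univ := by
    refine eq_univ_of_forall fun t => ?_
    obtain ⟨K, hK⟩ := hgr t (hFI t.2)
    obtain ⟨n, hn⟩ := exists_nat_ge K
    refine mem_iUnion.2 ⟨n, fun z => (hK z).trans ?_⟩
    gcongr
  obtain ⟨K, t₀, ht₀⟩ := nonempty_interior_of_iUnion_of_closed hQ hU
  obtain ⟨ρ, hρ, hball⟩ := Metric.mem_nhds_iff.1 (mem_interior_iff_mem_nhds.1 ht₀)
  refine ⟨K, t₀, t₀.2, ρ, hρ, fun s hs hst => ?_⟩
  exact hball (show (⟨s, hs⟩ : F) ∈ Metric.ball t₀ ρ by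
    rw [Metric.mem_ball, Subtype.dist_eq, Real.dist_eq]; exact hst)


/-- A flow in `𝓐_a` automatically grows locally uniformly in time, although its definition
involves no uniformity. The set `F` of times near which uniformity fails is closed. Were it
nonempty, then the growth would be uniform on a portion of `F`, by Baire's theorem; each time near
that portion and outside `F` is joined by an interval free of `F` to a point of the portion, from
which the evolution operator carries the bound over. -/
theorem IsFlow.locallyUniformGrowth {θ τ a : ℝ} (hθ : 0 ≤ θ) (hτ : 0 ≤ τ) (ha : 0 ≤ a)
    {w : ℝ → ℂ → ℂ} (hw : IsFlow θ τ (Icc 0 1) w) (hA : ∀ t ∈ Icc (0 : ℝ) 1, w t ∈ spaceA a) :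
    LocallyUniformGrowth (2 * (a + 2)) (Icc 0 1) w := by
  set b := a + 2 with hb
  have hb0 : 0 < b := by positivity
  let G : Set ℝ := {t | ∃ K : ℝ, ∀ᶠ s in 𝓝[Icc 0 1] t, ∀ z, ‖w s z‖ ≤ K * Real.exp (2 * b * ‖z‖)}
  let F : Set ℝ := Icc 0 1 \ G
  suffices hempty : F = ∅ by
    intro t ht
    by_contra hcon
    exact (eq_empty_iff_forall_notMem.1 hempty t) ⟨ht, hcon⟩
  by_contra hne
  have hGopen : IsOpen G := by
    rw [isOpen_iff_mem_nhds]
    rintro t ⟨K, hK⟩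
    filter_upwards [eventually_nhds_nhdsWithin.2 hK] with s hs
    exact ⟨K, hs⟩
  have hFclosed : IsClosed F := isClosed_Icc.sdiff hGopen
  have hFI : F ⊆ Icc 0 1 := sdiff_subset
  have hcoef : ∀ t ∈ Icc (0 : ℝ) 1, ∃ K : ℝ, ∀ k, ‖iteratedDeriv k (w t) 0‖ ≤ K * b ^ k :=
    fun t ht => geom_bound_of_mem_spaceA (hA t ht) ha (by linarith)
  obtain ⟨K, t₀, ht₀, ρ, hρ, hK⟩ := hw.exists_uniform_growth_on_portion (b := a + 1) hFI hFclosed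
    (nonempty_iff_ne_empty.2 hne) fun t ht => by
      obtain ⟨K, hK⟩ := geom_bound_of_mem_spaceA (hA t ht) ha (lt_add_one a)
      refine ⟨K, fun z => ?_⟩
      rw [eq_egf_of_differentiable (hA t ht).1]
      exact norm_egf_le hK z
  obtain ⟨K', hK'⟩ := exists_coeff_bound_of_growth (b := a + 1) (b' := b) (by positivity)
    (by linarith) K
  have hcoefF : ∀ s ∈ F, |s - t₀| < ρ → ∀ k, ‖iteratedDeriv k (w s) 0‖ ≤ K' * b ^ k :=
    fun s hs hst => hK' (w s) (hA s (hFI hs)).1 (hK s hs hst)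
  -- times at distance less than `r` lie within half of the life span of the evolution
  let r : ℝ := min ρ (1 / (2 * b * (τ + 1)))
  have hr : 0 < r := lt_min hρ (by positivity)
  have hrb : ∀ x, |x| < r → b * (|x| * τ) ≤ 1 / 2 := by
    intro x hx
    have h1 : |x| ≤ 1 / (2 * b * (τ + 1)) := (hx.trans_le (min_le_right _ _)).le
    rw [le_div_iff₀ (by positivity)] at h1
    nlinarith [abs_nonneg x, mul_nonneg hb0.le (abs_nonneg x)]
  -- the evolution from a point `p ∈ F` near `t₀` to a time `s`, with no points of `F` in between
  have hstep : ∀ (s p : ℝ) (S : Set ℝ), p ∈ F → s ∈ S → |p - t₀| < ρ → Convex ℝ S →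
      Convex ℝ (insert p S) → p ∈ closure S → insert p S ⊆ Icc 0 1 → Disjoint S F →
      (∀ x ∈ insert p S, ∀ y ∈ insert p S, |y - x| < r) →
      ∀ z, ‖w s z‖ ≤ K' * 2 ^ (⌈θ⌉₊ + 1) * Real.exp (2 * b * ‖z‖) := by
    intro s p S hpF hs hpt hS hT hcl hsub hdis hlen z
    have hSG : S ⊆ G := by
      intro x hx
      by_contra hcon
      exact disjoint_left.1 hdis hx ⟨hsub (mem_insert_of_mem p hx), hcon⟩
    have h := (hw.mono hsub).eq_evol_of_endpoint hθ hτ hb0 hS hT hcl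
      (fun t ht => hcoef t (hsub ht)) (fun x hx y hy => hrb _ (hlen x hx y hy))
      (fun t ht => (hSG ht).imp fun _ hK =>
        hK.filter_mono (nhdsWithin_mono t ((subset_insert p S).trans hsub))) hs
    rw [h]
    refine norm_evol_le hθ hb0 (hcoefF p hpF hpt) ?_ z
    rw [abs_mul, abs_of_nonneg hτ]
    exact hrb _ (hlen p (mem_insert p S) s (mem_insert_of_mem p hs))
  refine ht₀.2 ⟨max K' (K' * 2 ^ (⌈θ⌉₊ + 1)), ?_⟩
  filter_upwards [inter_mem_nhdsWithin (Icc (0 : ℝ) 1) (Metric.ball_mem_nhds t₀ hr)] with s hs z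
  obtain ⟨hs01, hsr⟩ := hs
  rw [Metric.mem_ball, Real.dist_eq] at hsr
  have hsρ : |s - t₀| < ρ := hsr.trans_le (min_le_left _ _)
  have ht₀1 := hFI ht₀
  by_cases hsF : s ∈ F
  · have h1 := norm_egf_le (hcoefF s hsF hsρ) z
    rw [← eq_egf_of_differentiable (hA s hs01).1] at h1
    have hK'0 : 0 ≤ K' := by simpa using (norm_nonneg _).trans (hcoefF s hsF hsρ 0)
    refine h1.trans (mul_le_mul (le_max_left _ _) (Real.exp_le_exp.2 ?_) (Real.exp_pos _).le
      (hK'0.trans (le_max_left _ _)))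
    nlinarith [mul_nonneg hb0.le (norm_nonneg z)]
  · suffices h : ‖w s z‖ ≤ K' * 2 ^ (⌈θ⌉₊ + 1) * Real.exp (2 * b * ‖z‖) from
      h.trans (mul_le_mul_of_nonneg_right (le_max_right _ _) (Real.exp_pos _).le)
    rcases lt_trichotomy t₀ s with hlt | heq | hlt
    · -- `p` is the last point of `F` before `s`
      have hcomp : IsCompact (F ∩ Icc t₀ s) := isCompact_Icc.inter_left hFclosed
      have hp := hcomp.sSup_mem ⟨t₀, ht₀, left_mem_Icc.2 hlt.le⟩
      set p := sSup (F ∩ Icc t₀ s)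
      have hps : p < s := lt_of_le_of_ne hp.2.2 fun h => hsF (h ▸ hp.1)
      have hins : insert p (Ioc p s) = Icc p s := Ioc_insert_left hps.le
      have hI : Icc p s ⊆ Icc t₀ s := Icc_subset_Icc_left hp.2.1
      rw [abs_of_pos (sub_pos.2 hlt)] at hsr
      refine hstep s p (Ioc p s) hp.1 (right_mem_Ioc.2 hps) ?_ (convex_Ioc p s)
        (hins ▸ convex_Icc p s) ?_ ?_ ?_ ?_ z
      · rw [abs_of_nonneg (sub_nonneg.2 hp.2.1)]
        linarith [min_le_left ρ (1 / (2 * b * (τ + 1)))]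
      · rw [closure_Ioc hps.ne]; exact left_mem_Icc.2 hps.le
      · rw [hins]; exact hI.trans (Icc_subset_Icc ht₀1.1 hs01.2)
      · refine disjoint_left.2 fun x hx hxF => ?_
        exact hx.1.not_ge (le_csSup hcomp.bddAbove ⟨hxF, hp.2.1.trans hx.1.le, hx.2⟩)
      · rw [hins]
        intro x hx y hy
        have h1 := hI hx
        have h2 := hI hy
        rw [abs_lt]
        constructor <;> linarith [h1.1, h1.2, h2.1, h2.2]
    · exact absurd (heq ▸ ht₀) hsF
    · -- `p` is the first point of `F` after `s`
      have hcomp : IsCompact (F ∩ Icc s t₀) := isCompact_Icc.inter_left hFclosed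
      have hp := hcomp.sInf_mem ⟨t₀, ht₀, right_mem_Icc.2 hlt.le⟩
      set p := sInf (F ∩ Icc s t₀)
      have hps : s < p := lt_of_le_of_ne hp.2.1 fun h => hsF (h ▸ hp.1)
      have hins : insert p (Ico s p) = Icc s p := Ico_insert_right hps.le
      have hI : Icc s p ⊆ Icc s t₀ := Icc_subset_Icc_right hp.2.2
      rw [abs_of_neg (sub_neg.2 hlt)] at hsr
      refine hstep s p (Ico s p) hp.1 (left_mem_Ico.2 hps) ?_ (convex_Ico s p)
        (hins ▸ convex_Icc s p) ?_ ?_ ?_ ?_ z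
      · rw [abs_of_nonpos (sub_nonpos.2 hp.2.2)]
        linarith [min_le_left ρ (1 / (2 * b * (τ + 1)))]
      · rw [closure_Ico hps.ne]; exact right_mem_Icc.2 hps.le
      · rw [hins]; exact hI.trans (Icc_subset_Icc hs01.1 ht₀1.2)
      · refine disjoint_left.2 fun x hx hxF => ?_
        exact hx.2.not_ge (csInf_le hcomp.bddBelow ⟨hxF, hx.1, hx.2.le.trans hp.2.2⟩)
      · rw [hins]
        intro x hx y hy
        have h1 := hI hx
        have h2 := hI hy
        rw [abs_lt]
        constructor <;> linarith [h1.1, h1.2, h2.1, h2.2]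

lemma IsCauchySolution.isFlow {θ τ : ℝ} {h : ℂ → ℂ} {u : ℝ → ℂ → ℂ}
    (hu : IsCauchySolution θ τ h u) : IsFlow θ τ (Icc 0 1) u := by
  obtain ⟨a, -, hA⟩ := hu.mem_spaceA
  exact ⟨fun t ht => (hA t ht).1, hu.equation⟩

lemma sub_mem_spaceA {a : ℝ} (ha : 0 ≤ a) {f g : ℂ → ℂ} (hf : f ∈ spaceA a) (hg : g ∈ spaceA a) :
    (fun z => f z - g z) ∈ spaceA a := by
  have e : (fun z => f z - g z) = egf (fun k => iteratedDeriv k f 0 - iteratedDeriv k g 0) := by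
    obtain ⟨K₁, h₁⟩ := geom_bound_of_mem_spaceA hf ha (lt_add_one a)
    obtain ⟨K₂, h₂⟩ := geom_bound_of_mem_spaceA hg ha (lt_add_one a)
    funext z
    conv_lhs => rw [eq_egf_of_differentiable hf.1, eq_egf_of_differentiable hg.1]
    simp only [egf, sub_mul]
    rw [(summable_egf h₁ z).tsum_sub (summable_egf h₂ z)]
  rw [e]
  refine egf_mem_spaceA ha fun b hb => ?_
  obtain ⟨K₁, h₁⟩ := geom_bound_of_mem_spaceA hf ha hb
  obtain ⟨K₂, h₂⟩ := geom_bound_of_mem_spaceA hg ha hb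
  refine ⟨K₁ + K₂, fun k => ?_⟩
  rw [add_mul]
  exact (norm_sub_le _ _).trans (add_le_add (h₁ k) (h₂ k))

theorem IsCauchySolution.unique {θ τ : ℝ} (hθ : 0 ≤ θ) (hτ : 0 ≤ τ) {h : ℂ → ℂ}
    {u v : ℝ → ℂ → ℂ} (hu : IsCauchySolution θ τ h u) (hv : IsCauchySolution θ τ h v) {t : ℝ}
    (ht : t ∈ Icc (0 : ℝ) 1) : u t = v t := by
  obtain ⟨a, ha, hA⟩ := hu.mem_spaceA
  obtain ⟨a', ha', hA'⟩ := hv.mem_spaceA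
  have hflow := hu.isFlow.sub hv.isFlow
  have ham : 0 ≤ max a a' := ha.trans (le_max_left _ _)
  have hgr := hflow.locallyUniformGrowth hθ hτ ham fun t ht => sub_mem_spaceA ham
    (spaceA_mono (le_max_left a a') (hA t ht)) (spaceA_mono (le_max_right a a') (hA' t ht))
  funext z
  refine sub_eq_zero.1 (hflow.eq_zero_of_locallyUniformGrowth hθ hτ (by positivity)
    (convex_Icc 0 1) hgr (left_mem_Icc.2 zero_le_one) ht (fun y => ?_) z)
  rw [hu.init, hv.init, sub_self]

/-! ### The renormalised Cauchy problem -/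

/-- The Cauchy problem on `[0, 1]` is solved by the evolution operator, when the type `a` of the
initial value satisfies `a τ < 1`. -/
lemma isCauchySolution_evol {θ τ a a' : ℝ} (hθ : 0 ≤ θ) (hτ : 0 ≤ τ) (ha : 0 ≤ a)
    (haτ : a * τ < 1) (ha' : 0 ≤ a') {h : ℂ → ℂ} (hh : h ∈ spaceA a)
    (hmem : ∀ t ∈ Icc (0 : ℝ) 1, evol θ (t * τ) h ∈ spaceA a') :
    IsCauchySolution θ τ h (fun t => evol θ (t * τ) h) := by
  obtain ⟨b, hab, hb⟩ : ∃ b, a < b ∧ b * τ < 1 := by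
    have hcont : Tendsto (fun b : ℝ => b * τ) (𝓝[>] a) (𝓝 (a * τ)) :=
      ((continuous_id.mul continuous_const).tendsto a).mono_left nhdsWithin_le_nhds
    obtain ⟨b, h1, h2⟩ := ((hcont.eventually_lt_const haτ).and self_mem_nhdsWithin).exists
    exact ⟨b, h2, h1⟩
  have hb0 : 0 < b := ha.trans_lt hab
  obtain ⟨K, hK⟩ := geom_bound_of_mem_spaceA hh ha hab
  refine ⟨⟨a', ha', hmem⟩, ?_, ?_⟩
  · rw [zero_mul, evol_zero hh.1]
  · have hflow := isFlow_evol (θ := θ) (p := 0) hθ hτ hb0 hK (I := Icc (0 : ℝ) 1) fun t ht => by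
      rw [sub_zero, abs_of_nonneg ht.1]
      calc b * (t * τ) = t * (b * τ) := by ring
        _ ≤ 1 * (b * τ) := mul_le_mul_of_nonneg_right ht.2 (by positivity)
        _ < 1 := by rwa [one_mul]
    simpa only [sub_zero] using hflow.equation

/-- One step of the renormalised problem; `I(g)` consists of the `τ` for which the growth of type,
from `α δ^{-λ}` to at most `α`, compensates its reduction by the renormalisation. -/
lemma exists_step {δ : ℕ} (hδ : 2 ≤ δ) {lam : ℝ} (hlam : 0 < lam) {α τ θ : ℝ} (hα : 0 ≤ α)
    (hτ : τ ∈ tauSet δ lam α) (hθ : 0 ≤ θ) {f : ℂ → ℂ} (hf : LaguerreLimit α f) :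
    ∃ u : ℝ → ℂ → ℂ, IsCauchySolution θ τ (renorm δ lam f) u ∧
      ∀ t ∈ Icc (0 : ℝ) 1, LaguerreLimit α (u t) := by
  have hδ1 : (1 : ℝ) < δ := by exact_mod_cast hδ
  have hδ0 : (0 : ℝ) < δ := by linarith
  obtain ⟨hτ0, hτ1⟩ := hτ
  set a := α * (δ : ℝ) ^ (-lam) with ha_def
  have hq : 0 < (δ : ℝ) ^ (-lam) := Real.rpow_pos_of_pos hδ0 _
  have hq1 : (δ : ℝ) ^ (-lam) < 1 := Real.rpow_lt_one_of_one_lt_of_neg hδ1 (by linarith)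
  have ha : 0 ≤ a := by positivity
  have haτ : a * τ ≤ 1 - (δ : ℝ) ^ (-lam) := by
    rcases eq_or_lt_of_le hα with h0 | h0
    · rw [ha_def, ← h0]; simpa using hq1.le
    · have h1 := hτ1 h0
      rw [le_div_iff₀ h0] at h1
      have h2 : (δ : ℝ) ^ (-lam) * (δ : ℝ) ^ lam = 1 := by
        rw [← Real.rpow_add hδ0]; simp
      calc a * τ = (δ : ℝ) ^ (-lam) * (τ * α) := by rw [ha_def]; ring
        _ ≤ (δ : ℝ) ^ (-lam) * ((δ : ℝ) ^ lam - 1) := mul_le_mul_of_nonneg_left h1 hq.le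
        _ = _ := by rw [mul_sub, h2, mul_one]
  have hlim := hf.renorm hδ lam
  have hev : ∀ t ∈ Icc (0 : ℝ) 1, LaguerreLimit α (evol θ (t * τ) (renorm δ lam f)) := by
    intro t ht
    have hle : a * (t * τ) ≤ a * τ := by
      refine mul_le_mul_of_nonneg_left ?_ ha
      exact mul_le_of_le_one_left hτ0 ht.2
    refine hlim.evol ha hθ (mul_nonneg ht.1 hτ0) (by linarith) ?_
    exact mul_le_mul_of_nonneg_left (by linarith) hα
  exact ⟨_, isCauchySolution_evol hθ hτ0 ha (by linarith) hα (hlim.mem_spaceA ha)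
    fun t ht => (hev t ht).mem_spaceA hα, hev⟩

/-- The induction hypothesis speaks of the value at time `1` only: this is all that the next step
uses, and for `n = 0` nothing else is prescribed. -/
lemma exists_renormSolution {δ : ℕ} (hδ : 2 ≤ δ) {lam : ℝ} (hlam : 0 < lam) {α τ θ : ℝ}
    (hα : 0 ≤ α) (hτ : τ ∈ tauSet δ lam α) (hθ : 0 ≤ θ) {g : ℂ → ℂ} (hg : LaguerreLimit α g)
    (n : ℕ) : ∃ f : ℝ → ℂ → ℂ, IsRenormSolution δ lam θ τ g n f ∧ LaguerreLimit α (f 1) ∧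
      ∀ u, IsRenormSolution δ lam θ τ g n u → u 1 = f 1 := by
  induction n with
  | zero => exact ⟨fun _ => g, rfl, hg, fun u hu => hu⟩
  | succ n ih =>
    obtain ⟨v, hv, hv1, hvu⟩ := ih
    obtain ⟨f, hf, hfl⟩ := exists_step hδ hlam hα hτ hθ hv1
    have h1 : (1 : ℝ) ∈ Icc (0 : ℝ) 1 := right_mem_Icc.2 zero_le_one
    refine ⟨f, ⟨v, hv, hf⟩, hfl 1 h1, ?_⟩
    rintro u ⟨v', hv', hu⟩
    rw [hvu v' hv'] at hu
    exact hu.unique hθ hτ.1 hf h1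

end LaguerreEvolution

end

theorem mainTheorem2
    (δ : ℕ) (hδ : 2 ≤ δ) (lam : ℝ) (hlam : 0 < lam)
    (g : ℂ → ℂ) (hg : g ∈ LaguerreEvolution.laguerrePos)
    (C : ℂ) (m : ℕ) (α : ℝ) (γ : ℕ → ℝ)
    (hrep : LaguerreEvolution.IsLaguerreRep g C m α γ)
    (τ : ℝ) (hτ : τ ∈ LaguerreEvolution.tauSet δ lam α)
    (n : ℕ) (hn : 1 ≤ n) (θ : ℝ) (hθ : 0 ≤ θ) :
    ∃ f : ℝ → ℂ → ℂ,
      LaguerreEvolution.IsRenormSolution δ lam θ τ g n f ∧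
      (∀ t ∈ Set.Icc (0 : ℝ) 1, f t ∈ LaguerreEvolution.laguerrePosA α) ∧
      (∀ u : ℝ → ℂ → ℂ, LaguerreEvolution.IsRenormSolution δ lam θ τ g n u →
        ∀ t ∈ Set.Icc (0 : ℝ) 1, u t = f t) := by
  have hα := hrep.alpha_nonneg
  obtain ⟨k, rfl⟩ : ∃ k, n = k + 1 := ⟨n - 1, by omega⟩
  obtain ⟨v, hv, hv1, hvu⟩ := LaguerreEvolution.exists_renormSolution hδ hlam hα hτ hθ
    (hrep.laguerreLimit hg.2) k
  obtain ⟨f, hf, hfl⟩ := LaguerreEvolution.exists_step hδ hlam hα hτ hθ hv1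
  refine ⟨f, ⟨v, hv, hf⟩, fun t ht => (hfl t ht).mem_laguerrePosA hα, ?_⟩
  rintro u ⟨v', hv', hu⟩ t ht
  rw [hvu v' hv'] at hu
  exact hu.unique hθ hτ.1 hf ht
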